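/- Let $\mathbb{F}_q$ be a finite field, $A=\mathbb{F}_q[T]$, and let $K$ be a nonarchimedean local field with valuation ring $R$, maximal ideal $\mathfrak{p}$ and residue field $\mathbb{F}_\mathfrak{p}=R/\mathfrak{p}$, equipped with a ring homomorphism $\gamma:A\to K$ with $\gamma(A)\subseteq R$. Let $K\{\tau\}$ be the ring of twisted polynomials over $K$, with $\tau c=c^q\tau$ for $c\in K$. A Drinfeld module over $K$ of rank $r\ge 1$ is a ring homomorphism $\phi:A\to K\{\tau\}$, $a\mapsto\phi_a=\gamma(a)+\sum_{i=1}^{r\deg a}g_i(a)\tau^i$, with $g_r(T)\neq 0$. An isogeny $u:\phi\to\psi$ is a nonzero $u\in K\{\tau\}$ with $u\phi_a=\psi_a u$ for all $a\in A$; it is an isomorphism if $u$ is a unit of $K\{\tau\}$. We say that $\phi$ has stable reduction if there is a ring homomorphism $\phi':A\to R\{\tau\}$ which, viewed over $K$, is a Drinfeld module isomorphic to $\phi$ over $K$, and whose reduction modulo $\mathfrak{p}$ is a Drinfeld module (of some rank $\geq 1$) over $\mathbb{F}_\mathfrak{p}$. For a nonzero prime ideal $\mathfrak{l}=(l)$ of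 $A$ with $\gamma(l)\ne 0$, let $A_\mathfrak{l}$ be the completion of $A$ at $\mathfrak{l}$, let $F_\mathfrak{l}$ be its fraction field, let $T_\mathfrak{l}(\phi)=\varprojlim_n\phi[\mathfrak{l}^n]$ be the Tate module, where $\phi[\mathfrak{l}^n]\subseteq K^{\mathrm{sep}}$ is the set of zeros of $\phi_{l^n}$, and let $V_\mathfrak{l}(\phi)=T_\mathfrak{l}(\phi)\otimes_{A_\mathfrak{l}}F_\mathfrak{l}$, with its action of $\mathrm{Gal}(K^{\mathrm{sep}}/K)$. Let $I_\mathfrak{p}\subseteq\mathrm{Gal}(K^{\mathrm{sep}}/K)$ be the inertia group. Let $u:\phi\to\psi$ be an isogeny between Drinfeld modules over $K$. Let $\mathfrak{l}$ be a nonzero prime ideal of $A$ different from the kernel of the composite $A\to R\to\mathbb{F}_\mathfrak{p}$ (the $A$-characteristic of the reduction). If every element of $I_\mathfrak{p}$ acts on $V_\mathfrak{l}(\phi)$ as a unipotent endomorphism, then $\psi$ has stable reduction. -/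

import Mathlib

open Polynomial ValuativeRel
open scoped TensorProduct

noncomputable section

/-! ### Twisted polynomials

Throughout, `Fq` is a finite field with `q` elements and `A = Fq[X]`. An `A`-field (or `A`-ring) is a
field (or commutative ring) `S` with `[Algebra Fq[X] S]`; the structure map `γ` is the algebra map. -/

section Twisted

variable (Fq : Type*) [Field Fq] [Finite Fq]

theorem add_pow_natCard_pow (S : Type*) [CommRing S] [Algebra Fq[X] S] (n : ℕ) (x y : S) :
    (x + y) ^ (Nat.card Fq ^ n) = x ^ (Nat.card Fq ^ n) + y ^ (Nat.card Fq ^ n) := by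
  obtain ⟨p, hp⟩ := CharP.exists Fq
  have := Fintype.ofFinite Fq
  obtain ⟨m, hpp, hm⟩ := FiniteField.card Fq p
  rcases subsingleton_or_nontrivial S with h | h
  · exact Subsingleton.elim _ _
  have : Fact p.Prime := ⟨hpp⟩
  have : CharP S p :=
    charP_of_injective_ringHom (f := (algebraMap Fq[X] S).comp C) (RingHom.injective _) p
  rw [Nat.card_eq_fintype_card, hm, ← pow_mul]
  exact add_pow_char_pow x y p _

/-- The action of `ℕ` on an `A`-ring through powers of the `q`-Frobenius: `n` acts by
`x ↦ x ^ (q ^ n)`. -/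
@[reducible]
def frobeniusAction (S : Type*) [CommRing S] [Algebra Fq[X] S] :
    MulSemiringAction (Multiplicative ℕ) S where
  smul n x := x ^ (Nat.card Fq ^ n.toAdd)
  one_smul x := by
    change x ^ (Nat.card Fq ^ 0) = x
    simp
  mul_smul m n x := by
    change x ^ (Nat.card Fq ^ (m.toAdd + n.toAdd)) =
      (x ^ (Nat.card Fq ^ n.toAdd)) ^ (Nat.card Fq ^ m.toAdd)
    rw [← pow_mul, ← pow_add, add_comm]
  smul_zero n := by
    change (0 : S) ^ (Nat.card Fq ^ n.toAdd) = 0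
    exact zero_pow (pow_ne_zero _ Nat.card_pos.ne')
  smul_add n x y := add_pow_natCard_pow Fq S n.toAdd x y
  smul_one n := by
    change (1 : S) ^ (Nat.card Fq ^ n.toAdd) = 1
    simp
  smul_mul n x y := by
    change (x * y) ^ (Nat.card Fq ^ n.toAdd) = _
    rw [mul_pow]
    rfl

/-- The twisted polynomial ring `S{τ}`, with `τ * c = c ^ q * τ`. -/
def TwistedPoly (S : Type*) [CommRing S] [Algebra Fq[X] S] : Type _ := SkewPolynomial S

namespace TwistedPoly

variable {S : Type*} [CommRing S] [Algebra Fq[X] S]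

instance : Ring (TwistedPoly Fq S) :=
  letI := frobeniusAction Fq S
  inferInstanceAs (Ring (SkewPolynomial S))

variable {Fq}

/-- The coefficient of `τ ^ n` (coefficients are written on the left). -/
def coeff (f : TwistedPoly Fq S) (n : ℕ) : S := SkewPolynomial.coeff (R := S) f n

variable (Fq S) in
/-- The action of twisted polynomials on an extension `L` of `S`: the element `∑ cₙ τⁿ` acts as the
additive endomorphism `x ↦ ∑ cₙ x ^ (q ^ n)` (see `evalHom_apply`). -/
def evalHom (L : Type*) [CommRing L] [Algebra Fq[X] L] [Algebra S L] :
    TwistedPoly Fq S →+* AddMonoid.End L :=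
  letI := frobeniusAction Fq S
  letI := frobeniusAction Fq L
  SkewMonoidAlgebra.liftNCRingHom (k := S) (G := Multiplicative ℕ)
    ((Module.toAddMonoidEnd L L).comp (algebraMap S L))
    (DistribMulAction.toAddMonoidEnd (Multiplicative ℕ) L)
    (by
      intro x n
      ext z
      change algebraMap S L (x ^ (Nat.card Fq ^ n.toAdd)) * z ^ (Nat.card Fq ^ n.toAdd) =
        (algebraMap S L x * z) ^ (Nat.card Fq ^ n.toAdd)
      rw [mul_pow, map_pow])

theorem evalHom_apply (L : Type*) [CommRing L] [Algebra Fq[X] L] [Algebra S L]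
    (f : TwistedPoly Fq S) (x : L) :
    evalHom Fq S L f x = ∑ n ∈ SkewPolynomial.support (R := S) f,
      algebraMap S L (f.coeff n) * x ^ (Nat.card Fq ^ n) := by
  let := frobeniusAction Fq S
  let := frobeniusAction Fq L
  have h : evalHom Fq S L f =
      ∑ n ∈ SkewMonoidAlgebra.support (k := S) (G := Multiplicative ℕ) f,
        Module.toAddMonoidEnd L L
            (algebraMap S L (SkewMonoidAlgebra.coeff (k := S) (G := Multiplicative ℕ) f n)) *
          DistribMulAction.toAddMonoidEnd (Multiplicative ℕ) L n := rfl
  refine (DFunLike.congr_fun h x).trans ((map_sum (AddMonoidHom.eval x) _ _).trans ?_)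
  exact (Finset.sum_map _ ⟨Multiplicative.toAdd, Multiplicative.toAdd.injective⟩
    fun n => algebraMap S L (f.coeff n) * x ^ (Nat.card Fq ^ n)).symm

end TwistedPoly

end Twisted

/-! ### Tate modules -/

section Tate

variable {A : Type*} [CommRing A] (l : A) (M : Type*) [AddCommGroup M] [Module A M]

/-- The `l`-adic Tate module of an `A`-module `M`: the inverse limit of the torsion modules
`M[lⁿ]` along the maps `M[lⁿ⁺¹] → M[lⁿ]` given by multiplication by `l`. -/
def TateModule : Submodule A (ℕ → M) where
  carrier := {x | x 0 = 0 ∧ ∀ n, l • x (n + 1) = x n}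
  zero_mem' := ⟨rfl, fun _ => smul_zero _⟩
  add_mem' := by
    rintro x y ⟨hx, hx'⟩ ⟨hy, hy'⟩
    exact ⟨by simp [hx, hy], fun n => by simp [hx', hy']⟩
  smul_mem' := by
    rintro a x ⟨hx, hx'⟩
    exact ⟨by simp [hx], fun n => by simp [smul_comm l a, hx']⟩

namespace TateModule

variable {l M}

theorem pow_smul_apply (x : TateModule l M) (n : ℕ) : l ^ n • x.1 n = 0 := by
  induction n with
  | zero => simpa using x.2.1
  | succ n ih => rw [pow_succ, mul_smul, x.2.2, ih]

theorem smul_apply_congr (x : TateModule l M) (n : ℕ) {a b : A}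
    (h : Ideal.Quotient.mk (Ideal.span {l} ^ n) a = Ideal.Quotient.mk (Ideal.span {l} ^ n) b) :
    a • x.1 n = b • x.1 n := by
  rw [Ideal.Quotient.eq, Ideal.span_singleton_pow, Ideal.mem_span_singleton'] at h
  obtain ⟨c, hc⟩ := h
  rw [← sub_eq_zero, ← sub_smul, ← hc, mul_smul, pow_smul_apply, smul_zero]

/-- The action of the completion `A_l = lim A / lⁿ` on the Tate module: `(aₙ) • (xₙ) = (aₙ • xₙ)`,
where `aₙ ∈ A / lⁿ` acts on `xₙ ∈ M[lⁿ]` through any representative. -/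
instance : SMul (AdicCompletion (Ideal.span {l}) A) (TateModule l M) where
  smul a x := ⟨fun n => (AdicCompletion.evalₐ (Ideal.span {l}) n a).out • x.1 n,
    by simp [x.2.1], fun n => by
      rw [smul_comm, x.2.2]
      apply smul_apply_congr
      obtain ⟨b, rfl⟩ := AdicCompletion.mk_surjective _ _ a
      have h := Ideal.Quotient.mk_out (AdicCompletion.evalₐ (Ideal.span {l}) (n + 1)
        (AdicCompletion.mk _ _ b))
      refine Eq.trans ?_ (Eq.trans (AdicCompletion.Ideal.mk_eq_mk (Ideal.span {l}) n.le_succ b)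
        ((Ideal.Quotient.mk_out _).trans (AdicCompletion.evalₐ_mk _ n b)).symm)
      exact (Ideal.Quotient.eq).2 (Ideal.pow_le_pow_right n.le_succ
        ((Ideal.Quotient.eq).1 (h.trans (AdicCompletion.evalₐ_mk _ (n + 1) b))))⟩

theorem completion_smul_apply (a : AdicCompletion (Ideal.span {l}) A) (x : TateModule l M) (n : ℕ)
    {b : A} (h : AdicCompletion.evalₐ (Ideal.span {l}) n a = Ideal.Quotient.mk _ b) :
    (a • x).1 n = b • x.1 n :=
  smul_apply_congr x n ((Ideal.Quotient.mk_out _).trans h)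

instance : Module (AdicCompletion (Ideal.span {l}) A) (TateModule l M) where
  one_smul x := Subtype.ext <| funext fun n => by
    rw [completion_smul_apply 1 x n (b := 1) (by simp), one_smul]
  mul_smul a b x := Subtype.ext <| funext fun n => by
    obtain ⟨r, hr⟩ := Ideal.Quotient.mk_surjective (AdicCompletion.evalₐ (Ideal.span {l}) n a)
    obtain ⟨s, hs⟩ := Ideal.Quotient.mk_surjective (AdicCompletion.evalₐ (Ideal.span {l}) n b)
    rw [completion_smul_apply (a * b) x n (b := r * s) (by simp [hr, hs]),
      completion_smul_apply a _ n hr.symm, completion_smul_apply b x n hs.symm, mul_smul]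
  smul_zero a := Subtype.ext <| funext fun n => smul_zero _
  smul_add a x y := Subtype.ext <| funext fun n => smul_add _ _ _
  add_smul a b x := Subtype.ext <| funext fun n => by
    obtain ⟨r, hr⟩ := Ideal.Quotient.mk_surjective (AdicCompletion.evalₐ (Ideal.span {l}) n a)
    obtain ⟨s, hs⟩ := Ideal.Quotient.mk_surjective (AdicCompletion.evalₐ (Ideal.span {l}) n b)
    change _ = (a • x).1 n + (b • x).1 n
    rw [completion_smul_apply (a + b) x n (b := r + s) (by simp [hr, hs]),
      completion_smul_apply a _ n hr.symm, completion_smul_apply b x n hs.symm, add_smul]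
  zero_smul x := Subtype.ext <| funext fun n => by
    rw [completion_smul_apply 0 x n (b := 0) (by simp), zero_smul]
    rfl

variable {N : Type*} [AddCommGroup N] [Module A N]

/-- The map of Tate modules induced by an `A`-linear map. -/
def map (f : M →ₗ[A] N) :
    TateModule l M →ₗ[AdicCompletion (Ideal.span {l}) A] TateModule l N where
  toFun x := ⟨fun n => f (x.1 n), by simp [x.2.1], fun n => by rw [← map_smul, x.2.2]⟩
  map_add' x y := Subtype.ext <| funext fun n => map_add f _ _
  map_smul' a x := Subtype.ext <| funext fun n => map_smul f _ _

end TateModule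

/-- The rational Tate module `V_l = T_l ⊗ F_l`, where `F_l` is the fraction field of the completion
`A_l`. -/
abbrev RationalTateModule : Type _ :=
  FractionRing (AdicCompletion (Ideal.span {l}) A) ⊗[AdicCompletion (Ideal.span {l}) A]
    TateModule l M

end Tate

/-! ### Drinfeld modules -/

section Drinfeld

variable (Fq : Type*) [Field Fq] [Finite Fq]

/-- A Drinfeld `Fq[X]`-module over an `Fq[X]`-field `K`. -/
structure DrinfeldModule (K : Type*) [Field K] [Algebra Fq[X] K] where
  /-- The ring homomorphism `a ↦ φ_a`. -/
  toRingHom : Fq[X] →+* TwistedPoly Fq K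
  /-- The rank `r`. -/
  rank : ℕ
  one_le_rank : 1 ≤ rank
  coeff_zero : ∀ a, (toRingHom a).coeff 0 = algebraMap Fq[X] K a
  coeff_eq_zero : ∀ a n, rank * a.natDegree < n → (toRingHom a).coeff n = 0
  coeff_rank_ne_zero : (toRingHom X).coeff rank ≠ 0

namespace DrinfeldModule

variable {Fq} {K : Type*} [Field K] [Algebra Fq[X] K]

/-- `u` is an isogeny from `φ` to `ψ`. -/
def IsIsogeny (φ ψ : DrinfeldModule Fq K) (u : TwistedPoly Fq K) : Prop :=
  u ≠ 0 ∧ ∀ a, u * φ.toRingHom a = ψ.toRingHom a * u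

/-- `φ` and `ψ` are isomorphic over `K`. -/
def IsIsomorphic (φ ψ : DrinfeldModule Fq K) : Prop :=
  ∃ u : TwistedPoly Fq K, IsUnit u ∧ ∀ a, u * φ.toRingHom a = ψ.toRingHom a * u

/-- The `Fq[X]`-module `ᵠL`: the additive group of an extension `L` of `K`, on which `a` acts through
`φ_a`. -/
def Points (_φ : DrinfeldModule Fq K) (L : Type*) : Type _ := L

section Points

variable (φ : DrinfeldModule Fq K) (L : Type*) [Field L] [Algebra Fq[X] L] [Algebra K L]

instance : AddCommGroup (φ.Points L) := inferInstanceAs (AddCommGroup L)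

instance : Module Fq[X] (φ.Points L) :=
  letI : Module (AddMonoid.End L) (φ.Points L) := inferInstanceAs (Module (AddMonoid.End L) L)
  Module.compHom (φ.Points L) ((TwistedPoly.evalHom Fq K L).comp φ.toRingHom)

theorem points_smul_def (a : Fq[X]) (x : φ.Points L) :
    a • x = (TwistedPoly.evalHom Fq K L (φ.toRingHom a) x : L) := rfl

variable {L} in
/-- A `K`-automorphism of `L` commutes with the action of `Fq[X]` on `ᵠL`. -/
def galoisMap (σ : L ≃ₐ[K] L) : φ.Points L →ₗ[Fq[X]] φ.Points L where
  toFun x := σ x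
  map_add' x y := map_add σ x y
  map_smul' a x := by
    have key (f : TwistedPoly Fq K) (y : L) :
        σ (TwistedPoly.evalHom Fq K L f y) = TwistedPoly.evalHom Fq K L f (σ y) := by
      simp [TwistedPoly.evalHom_apply]
    exact key (φ.toRingHom a) x

end Points

/-- The rational `l`-adic representation of `Gal(Kˢᵉᵖ/K)` on `V_l(φ)`. The torsion is taken in the
separable closure, which contains all the `lⁿ`-torsion whenever `γ(l) ≠ 0`. -/
def rationalTateRep (φ : DrinfeldModule Fq K) (l : Fq[X]) :
    Representation (FractionRing (AdicCompletion (Ideal.span {l}) Fq[X]))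
      Gal(SeparableClosure K/K) (RationalTateModule l (φ.Points (SeparableClosure K))) where
  toFun σ := (TateModule.map (φ.galoisMap σ)).baseChange _
  map_one' := by
    have : TateModule.map (l := l) (φ.galoisMap (1 : Gal(SeparableClosure K/K))) =
      LinearMap.id := rfl
    rw [this, LinearMap.baseChange_id]
    rfl
  map_mul' σ τ := by
    have : TateModule.map (l := l) (φ.galoisMap (σ * τ)) =
      (TateModule.map (φ.galoisMap σ)).comp (TateModule.map (φ.galoisMap τ)) := rfl
    rw [this, LinearMap.baseChange_comp]
    rfl

end DrinfeldModule

end Drinfeld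

/-! ### Local fields -/

section Local

/-- The inertia subgroup of the absolute Galois group of a nonarchimedean local field: the
automorphisms acting trivially on the ring of integers `O` of the separable closure modulo its
maximal ideal. As `K` is complete, `O` is local, so its maximal ideal is the Jacobson radical. -/
def inertiaGroup (K : Type*) [Field K] [ValuativeRel K] : Subgroup Gal(SeparableClosure K/K) :=
  ((⊥ : Ideal (integralClosure 𝒪[K] (SeparableClosure K))).jacobson).inertia
    Gal(SeparableClosure K/K)

variable {Fq : Type*} [Field Fq] [Finite Fq] {K : Type*} [Field K] [ValuativeRel K]
  [Algebra Fq[X] K] [Algebra Fq[X] 𝒪[K]]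

/-- `φ` has stable reduction: it is isomorphic over `K` to some `φ'` with coefficients in `𝒪[K]`
whose reduction modulo the maximal ideal is a Drinfeld module over the residue field. -/
def DrinfeldModule.HasStableReduction (φ : DrinfeldModule Fq K) : Prop :=
  ∃ (φ' : Fq[X] →+* TwistedPoly Fq 𝒪[K]) (φK : DrinfeldModule Fq K)
    (φbar : DrinfeldModule Fq 𝓀[K]),
    (∀ a n, (φK.toRingHom a).coeff n = algebraMap 𝒪[K] K ((φ' a).coeff n)) ∧
    φK.IsIsomorphic φ ∧
    (∀ a n, (φbar.toRingHom a).coeff n = IsLocalRing.residue 𝒪[K] ((φ' a).coeff n))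

end Local

end

noncomputable section

set_option linter.unusedSectionVars false

/-! ### Arithmetic of twisted polynomials -/

namespace TwistedPoly

section CommRing

variable {Fq : Type*} [Field Fq] [Finite Fq] {S : Type*} [CommRing S] [Algebra Fq[X] S]

/-! It suffices to treat `φ` itself, because stable reduction passes along isogenies
(`HasStableReduction.of_isIsogeny`). That is a Gauss lemma: twisted polynomials over the residue
field have no zero divisors, so if a primitive `U` intertwines an integral `φ'` with a conjugate of
`ψ`, that conjugate is integral too, and degrees modulo the maximal ideal give its reduction the
rank of the reduction of `φ'`.

For `φ`, write `φ_X = ∑ g_i τ^i`. Conjugation by `c` multiplies `g_i` by `c^(q^i - 1)`. Choose `j ≥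
1` on the first slope of the Newton polygon, put `n = q^j - 1`, and take `c` in the separable
closure with `c^n = g_j⁻¹`. Then `c⁻¹ φ c` is integral with `j`-th coefficient `1`, so only the
ramification of `c` is at stake.

As `l` is a unit in `𝒪[K]`, the reduction of `c⁻¹ φ c` has nonzero `l`-torsion, which lifts to an
`l`-torsion point `c / y` of `φ` with `y` an integral unit (`exists_torsion_of_scaling`). In
characteristic `p` a unipotent `σ` has `p`-power order, so some `σ^(p^k)` fixes `c / y`
(`exists_pow_fixes_torsion`). But `σ c / c` is an `n`-th root of unity with `n` prime to `p`, and
inertia acts trivially on residues, which forces `σ c = c` (`inertia_apply_eq_self`). Thus `c` is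
unramified, the valuation of `g_j` is an `n`-th power in the value group of `K`
(`exists_valuation_pow_mul_eq_one`), and `c` can be replaced by some `d` in `K`. -/

theorem ext_coeff {f g : TwistedPoly Fq S} (h : ∀ n, f.coeff n = g.coeff n) : f = g :=
  SkewPolynomial.ext (R := S) h

@[simp]
theorem coeff_zero (n : ℕ) : (0 : TwistedPoly Fq S).coeff n = 0 := rfl

@[simp]
theorem coeff_add (f g : TwistedPoly Fq S) (n : ℕ) :
    (f + g).coeff n = f.coeff n + g.coeff n :=
  DFunLike.congr_fun (SkewMonoidAlgebra.coeff_add (k := S) (G := Multiplicative ℕ) f g) _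

theorem coeff_mul (f g : TwistedPoly Fq S) (n : ℕ) :
    (f * g).coeff n =
      ∑ p ∈ Finset.HasAntidiagonal.antidiagonal n, f.coeff p.1 * g.coeff p.2 ^ (Nat.card Fq ^ p.1) := by
  let := frobeniusAction Fq S
  refine (SkewMonoidAlgebra.coeff_mul_antidiagonal_of_finset (k := S) (G := Multiplicative ℕ)
    f g (Multiplicative.ofAdd n) ((Finset.HasAntidiagonal.antidiagonal n).map
      ⟨fun p => (Multiplicative.ofAdd p.1, Multiplicative.ofAdd p.2), fun p q h => h⟩) ?_).trans ?_
  · rintro ⟨a, b⟩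
    simp only [Finset.mem_map, Finset.HasAntidiagonal.mem_antidiagonal]
    constructor
    · rintro ⟨p, hp, h⟩
      obtain ⟨rfl, rfl⟩ := Prod.mk.inj h
      rw [← hp]
      rfl
    · intro h
      exact ⟨(a.toAdd, b.toAdd), h, rfl⟩
  · rw [Finset.sum_map]
    rfl

/-- The twisted polynomial with prescribed coefficients. -/
def ofFinsupp (f : ℕ →₀ S) : TwistedPoly Fq S :=
  SkewMonoidAlgebra.ofCoeff (k := S) (G := Multiplicative ℕ) f

@[simp]
theorem coeff_ofFinsupp (f : ℕ →₀ S) (n : ℕ) : (ofFinsupp f : TwistedPoly Fq S).coeff n = f n := rfl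

/-- The coefficients of a twisted polynomial. -/
def toFinsupp (f : TwistedPoly Fq S) : ℕ →₀ S :=
  SkewMonoidAlgebra.coeff (k := S) (G := Multiplicative ℕ) f

@[simp]
theorem toFinsupp_apply (f : TwistedPoly Fq S) (n : ℕ) : f.toFinsupp n = f.coeff n := rfl

theorem exists_coeff_eq_zero (f : TwistedPoly Fq S) : ∃ N, ∀ n, N ≤ n → f.coeff n = 0 := by
  refine ⟨f.toFinsupp.support.sup id + 1, fun n hn => ?_⟩
  by_contra h
  have h1 : n ∈ f.toFinsupp.support := Finsupp.mem_support_iff.2 h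
  have := Finset.le_sup (f := id) h1
  simp only [id_eq] at this
  omega

theorem exists_coeff_ne_zero {f : TwistedPoly Fq S} (hf : f ≠ 0) : ∃ n, f.coeff n ≠ 0 := by
  by_contra! h
  exact hf (ext_coeff h)

variable (Fq) in
/-- Constants, as a ring homomorphism. -/
def C : S →+* TwistedPoly Fq S :=
  letI := frobeniusAction Fq S
  SkewPolynomial.CRingHom

theorem coeff_C (c : S) (n : ℕ) : (C Fq c).coeff n = if n = 0 then c else 0 :=
  SkewPolynomial.coeff_C

theorem coeff_one (n : ℕ) : (1 : TwistedPoly Fq S).coeff n = if n = 0 then 1 else 0 := by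
  rw [← map_one (C Fq), coeff_C]

@[simp]
theorem coeff_C_mul (c : S) (f : TwistedPoly Fq S) (n : ℕ) :
    (C Fq c * f).coeff n = c * f.coeff n := by
  let := frobeniusAction Fq S
  exact SkewMonoidAlgebra.coeff_single_one_mul (k := S) (G := Multiplicative ℕ) f c _

@[simp]
theorem coeff_mul_C (c : S) (f : TwistedPoly Fq S) (n : ℕ) :
    (f * C Fq c).coeff n = f.coeff n * c ^ (Nat.card Fq ^ n) := by
  let := frobeniusAction Fq S
  exact SkewMonoidAlgebra.coeff_mul_single_one (k := S) (G := Multiplicative ℕ) f c _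

theorem eq_C_of_coeff_eq_zero {f : TwistedPoly Fq S} (h : ∀ n, 0 < n → f.coeff n = 0) :
    f = C Fq (f.coeff 0) := by
  refine ext_coeff fun n => ?_
  rw [coeff_C]
  split_ifs with hn
  · rw [hn]
  · exact h n (Nat.pos_of_ne_zero hn)

theorem isUnit_C {c : S} (hc : IsUnit c) : IsUnit (C Fq c) := hc.map _

variable {S' : Type*} [CommRing S'] [Algebra Fq[X] S']

variable (Fq) in
/-- The ring homomorphism between twisted polynomial rings induced by a ring homomorphism of
coefficients. -/
def map (f : S →+* S') : TwistedPoly Fq S →+* TwistedPoly Fq S' where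
  toFun p := ofFinsupp (p.toFinsupp.mapRange f (map_zero f))
  map_zero' := ext_coeff fun n => by simp
  map_add' p q := ext_coeff fun n => by simp
  map_one' := ext_coeff fun n => by
    simp only [coeff_ofFinsupp, Finsupp.mapRange_apply, toFinsupp_apply, coeff_one]
    split_ifs <;> simp
  map_mul' p q := ext_coeff fun n => by
    simp [coeff_mul, map_sum]

@[simp]
theorem coeff_map (f : S →+* S') (p : TwistedPoly Fq S) (n : ℕ) :
    (map Fq f p).coeff n = f (p.coeff n) := rfl

theorem map_injective {f : S →+* S'} (hf : Function.Injective f) :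
    Function.Injective (map Fq f) := fun p q h => ext_coeff fun n => hf <| by
  rw [← coeff_map, ← coeff_map, h]

theorem mem_range_map {f : S →+* S'} {p : TwistedPoly Fq S'} :
    p ∈ (map Fq f).range ↔ ∀ n, p.coeff n ∈ f.range := by
  constructor
  · rintro ⟨p, rfl⟩ n
    exact ⟨p.coeff n, rfl⟩
  · intro h
    choose g hg using h
    classical
    -- The chosen preimage of `0` need not be `0`, so it is overridden to keep the support finite.
    refine ⟨ofFinsupp (Finsupp.onFinset p.toFinsupp.support
      (fun n => if p.coeff n = 0 then 0 else g n) fun n hn => ?_), ext_coeff fun n => ?_⟩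
    · rw [Finsupp.mem_support_iff, toFinsupp_apply]
      intro h0
      simp [h0] at hn
    · rw [coeff_map, coeff_ofFinsupp, Finsupp.onFinset_apply]
      split_ifs with h0
      · rw [h0, map_zero]
      · exact hg n

/-- A ring homomorphism from `Fq[X]` whose values on the generators have integral coefficients
factors through the integral twisted polynomials. -/
theorem exists_lift_ringHom {f : S →+* S'} (hf : Function.Injective f)
    (θ : Fq[X] →+* TwistedPoly Fq S') (hC : ∀ a n, (θ (Polynomial.C a)).coeff n ∈ f.range)
    (hX : ∀ n, (θ X).coeff n ∈ f.range) :
    ∃ θ' : Fq[X] →+* TwistedPoly Fq S, ∀ a, map Fq f (θ' a) = θ a := by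
  have h (a : Fq[X]) : θ a ∈ (map Fq f).range := by
    induction a using Polynomial.induction_on' with
    | add p q hp hq => rw [map_add]; exact add_mem hp hq
    | monomial n a =>
      rw [← C_mul_X_pow_eq_monomial, map_mul, map_pow]
      exact mul_mem (mem_range_map.2 (hC a)) (pow_mem (mem_range_map.2 hX) n)
  let e := RingEquiv.ofLeftInverse (Function.leftInverse_invFun (map_injective (Fq := Fq) hf))
  refine ⟨(e.symm : (map Fq f).range →+* TwistedPoly Fq S).comp (θ.codRestrict _ h), fun a => ?_⟩
  have := e.apply_symm_apply (θ.codRestrict _ h a)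
  exact congrArg Subtype.val this

/-- Conjugation of a ring homomorphism by a constant. -/
def conj (θ : Fq[X] →+* TwistedPoly Fq S) (c : Sˣ) : Fq[X] →+* TwistedPoly Fq S where
  toFun a := C Fq (↑c⁻¹ : S) * θ a * C Fq (c : S)
  map_zero' := by simp
  map_one' := by rw [map_one, mul_one, ← map_mul, Units.inv_mul, map_one]
  map_add' a b := by rw [map_add, mul_add, add_mul]
  map_mul' a b := by
    have h : C Fq (c : S) * C Fq (↑c⁻¹ : S) = 1 := by
      rw [← map_mul, Units.mul_inv, map_one]
    rw [map_mul]
    calc C Fq (↑c⁻¹ : S) * (θ a * θ b) * C Fq (c : S)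
        = C Fq (↑c⁻¹ : S) * θ a * 1 * θ b * C Fq (c : S) := by simp only [mul_assoc, one_mul]
      _ = _ := by rw [← h]; simp only [mul_assoc]

theorem conj_apply (θ : Fq[X] →+* TwistedPoly Fq S) (c : Sˣ) (a : Fq[X]) :
    conj θ c a = C Fq (↑c⁻¹ : S) * θ a * C Fq (c : S) := rfl

/-- This is `τ^n c = c^(q^n) τ^n`. The weights `q^n - 1` govern the slope argument; the weight is
`0` at `n = 0`, so the constant term does not move. -/
theorem coeff_conj (θ : Fq[X] →+* TwistedPoly Fq S) (c : Sˣ) (a : Fq[X]) (n : ℕ) :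
    (conj θ c a).coeff n = (θ a).coeff n * (c : S) ^ (Nat.card Fq ^ n - 1) := by
  have h : Nat.card Fq ^ n = (Nat.card Fq ^ n - 1) + 1 :=
    (Nat.succ_pred_eq_of_pos (pow_pos Nat.card_pos n)).symm
  rw [conj_apply, coeff_mul_C, coeff_C_mul]
  conv_lhs => rw [h, pow_succ]
  calc (↑c⁻¹ : S) * (θ a).coeff n * ((c : S) ^ (Nat.card Fq ^ n - 1) * c)
      = (θ a).coeff n * (c : S) ^ (Nat.card Fq ^ n - 1) * (↑c⁻¹ * c) := by ring
    _ = _ := by rw [Units.inv_mul, mul_one]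

end CommRing

/-! ### Degrees of twisted polynomials over a field -/

section Field

variable {Fq : Type*} [Field Fq] [Finite Fq] {k : Type*} [Field k] [Algebra Fq[X] k]

/-- `f` has degree `n` in `τ`. -/
def HasDegree (f : TwistedPoly Fq k) (n : ℕ) : Prop :=
  f.coeff n ≠ 0 ∧ ∀ m, n < m → f.coeff m = 0

theorem exists_hasDegree {f : TwistedPoly Fq k} {i : ℕ} (hi : f.coeff i ≠ 0) :
    ∃ n, i ≤ n ∧ f.HasDegree n := by
  classical
  obtain ⟨N, hN⟩ := f.exists_coeff_eq_zero
  have hiN : i ≤ N := by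
    by_contra h
    exact hi (hN i (by omega))
  refine ⟨Nat.findGreatest (fun n => f.coeff n ≠ 0) N, Nat.le_findGreatest hiN hi,
    Nat.findGreatest_spec (P := fun n => f.coeff n ≠ 0) hiN hi, fun m hm => ?_⟩
  by_cases hmN : m ≤ N
  · simpa using Nat.findGreatest_is_greatest hm hmN
  · exact hN m (by omega)

theorem HasDegree.unique {f : TwistedPoly Fq k} {m n : ℕ} (hm : f.HasDegree m)
    (hn : f.HasDegree n) : m = n := by
  rcases lt_trichotomy m n with h | h | h
  · exact absurd (hm.2 n h) hn.1
  · exact h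
  · exact absurd (hn.2 m h) hm.1

theorem HasDegree.mul {f g : TwistedPoly Fq k} {m n : ℕ} (hf : f.HasDegree m)
    (hg : g.HasDegree n) : (f * g).HasDegree (m + n) := by
  have hq (i : ℕ) : Nat.card Fq ^ i ≠ 0 := pow_ne_zero _ Nat.card_pos.ne'
  constructor
  · rw [coeff_mul, Finset.sum_eq_single (m, n)]
    · exact mul_ne_zero hf.1 (pow_ne_zero _ hg.1)
    · rintro ⟨i, j⟩ hij hne
      rw [Finset.HasAntidiagonal.mem_antidiagonal] at hij
      simp only at hij
      by_cases hi : m < i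
      · simp [hf.2 i hi]
      · have hj : n < j := by
          rcases eq_or_ne i m with rfl | h
          · exact absurd (by rw [show j = n by omega]) hne
          · omega
        rw [hg.2 j hj, zero_pow (hq i), mul_zero]
    · intro h
      exact absurd (Finset.HasAntidiagonal.mem_antidiagonal.2 (rfl : m + n = m + n)) h
  · intro r hr
    rw [coeff_mul]
    refine Finset.sum_eq_zero ?_
    rintro ⟨i, j⟩ hij
    rw [Finset.HasAntidiagonal.mem_antidiagonal] at hij
    simp only at hij
    by_cases hi : m < i
    · simp [hf.2 i hi]
    · rw [hg.2 j (by omega), zero_pow (hq i), mul_zero]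

/-- Over the residue field this is what makes a product of primitive twisted polynomials primitive.
-/
theorem mul_ne_zero_of_ne_zero {f g : TwistedPoly Fq k} (hf : f ≠ 0) (hg : g ≠ 0) : f * g ≠ 0 := by
  obtain ⟨i, hi⟩ := exists_coeff_ne_zero hf
  obtain ⟨j, hj⟩ := exists_coeff_ne_zero hg
  obtain ⟨m, -, hm⟩ := exists_hasDegree hi
  obtain ⟨n, -, hn⟩ := exists_hasDegree hj
  intro h
  exact (hm.mul hn).1 (by rw [h, coeff_zero])

theorem HasDegree.add_C {f : TwistedPoly Fq k} {n : ℕ} (hf : f.HasDegree n) (hn : 0 < n) (c : k) :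
    (f + C Fq c).HasDegree n := by
  constructor
  · rw [coeff_add, coeff_C, if_neg hn.ne', add_zero]
    exact hf.1
  · intro m hm
    rw [coeff_add, coeff_C, if_neg (by omega), add_zero]
    exact hf.2 m hm

/-- If `θ X` has degree `r ≥ 1`, then `θ a` has degree `r * deg a` for all `a ≠ 0`. -/
theorem hasDegree_ringHom (θ : Fq[X] →+* TwistedPoly Fq k)
    (hC : ∀ a n, 0 < n → (θ (Polynomial.C a)).coeff n = 0) {r : ℕ} (hr : 1 ≤ r)
    (hX : (θ X).HasDegree r) {a : Fq[X]} (ha : a ≠ 0) :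
    (θ a).HasDegree (r * a.natDegree) := by
  have hconst (b : Fq) : θ (Polynomial.C b) = C Fq ((θ (Polynomial.C b)).coeff 0) :=
    eq_C_of_coeff_eq_zero (hC b)
  induction h : a.natDegree generalizing a with
  | zero =>
    obtain ⟨b, rfl⟩ := natDegree_eq_zero.1 h
    refine ⟨fun h0 => ?_, fun m hm => hC b m (by omega)⟩
    have hb : b ≠ 0 := fun h => ha (by rw [h, map_zero])
    have h1 : θ (Polynomial.C b) = 0 := by
      rw [hconst b, ← mul_zero r, h0, map_zero]
    have h2 : θ (Polynomial.C b * Polynomial.C b⁻¹) = 0 := by rw [map_mul, h1, zero_mul]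
    rw [← map_mul, mul_inv_cancel₀ hb, map_one, map_one] at h2
    have h3 := congrArg (fun f => coeff f 0) h2
    simp [coeff_one] at h3
  | succ d ih =>
    -- Splitting off the constant term of `a` alters only the coefficient of `τ^0`, far from the
    -- leading one.
    have h1 : a.divX.natDegree = d := by rw [natDegree_divX_eq_natDegree_tsub_one, h]; rfl
    have h2 : a.divX ≠ 0 := by
      intro h0
      rw [divX_eq_zero_iff] at h0
      rw [h0, natDegree_C] at h
      omega
    rw [← divX_mul_X_add a, map_add, map_mul, hconst]
    refine HasDegree.add_C ?_ (by positivity) _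
    rw [mul_add, mul_one]
    exact (ih h2 h1).mul hX

end Field

end TwistedPoly

/-! ### Stable reduction and isogenies -/

section Valuation

variable {K : Type*} [Field K] [ValuativeRel K]

theorem mem_range_algebraMap_integer {x : K} :
    x ∈ (algebraMap 𝒪[K] K).range ↔ valuation K x ≤ 1 :=
  ⟨fun ⟨y, hy⟩ => hy ▸ y.2, fun h => ⟨⟨x, h⟩, rfl⟩⟩

theorem residue_ne_zero_iff {x : 𝒪[K]} :
    IsLocalRing.residue 𝒪[K] x ≠ 0 ↔ valuation K (x : K) = 1 := by
  rw [IsLocalRing.residue_ne_zero_iff_isUnit]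
  exact (Valuation.integer.integers (valuation K)).isUnit_iff_valuation_eq_one

end Valuation

namespace DrinfeldModule

variable {Fq : Type*} [Field Fq] [Finite Fq] {K : Type*} [Field K]

section Basic

variable [Algebra Fq[X] K]

theorem coeff_C_eq_zero (φ : DrinfeldModule Fq K) (a : Fq) {n : ℕ} (hn : 0 < n) :
    (φ.toRingHom (C a)).coeff n = 0 :=
  φ.coeff_eq_zero _ _ (by simpa using hn)

theorem hasDegree_X (φ : DrinfeldModule Fq K) : (φ.toRingHom X).HasDegree φ.rank :=
  ⟨φ.coeff_rank_ne_zero, fun m hm => φ.coeff_eq_zero _ _ (by simpa using hm)⟩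

/-- The Drinfeld module `c⁻¹ φ c`, isomorphic to `φ`. -/
def twist (φ : DrinfeldModule Fq K) (c : Kˣ) : DrinfeldModule Fq K where
  toRingHom := TwistedPoly.conj φ.toRingHom c
  rank := φ.rank
  one_le_rank := φ.one_le_rank
  coeff_zero a := by simp [TwistedPoly.coeff_conj, φ.coeff_zero]
  coeff_eq_zero a n h := by rw [TwistedPoly.coeff_conj, φ.coeff_eq_zero a n h, zero_mul]
  coeff_rank_ne_zero := by
    rw [TwistedPoly.coeff_conj]
    exact mul_ne_zero φ.coeff_rank_ne_zero (pow_ne_zero _ c.ne_zero)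

theorem twist_isIsomorphic (φ : DrinfeldModule Fq K) (c : Kˣ) : (φ.twist c).IsIsomorphic φ := by
  refine ⟨TwistedPoly.C Fq (c : K), TwistedPoly.isUnit_C c.isUnit, fun a => ?_⟩
  have h : TwistedPoly.C Fq (c : K) * TwistedPoly.C Fq (↑c⁻¹ : K) = 1 := by
    rw [← map_mul, Units.mul_inv, map_one]
  change TwistedPoly.C Fq (c : K) * (TwistedPoly.C Fq (↑c⁻¹ : K) * φ.toRingHom a *
    TwistedPoly.C Fq (c : K)) = _
  rw [← mul_assoc, ← mul_assoc, h, one_mul]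

end Basic

variable [ValuativeRel K] [Algebra Fq[X] K] [Algebra Fq[X] 𝒪[K]] [IsScalarTower Fq[X] 𝒪[K] K]

theorem algebraMap_integer_apply (a : Fq[X]) :
    algebraMap 𝒪[K] K (algebraMap Fq[X] 𝒪[K] a) = algebraMap Fq[X] K a :=
  (IsScalarTower.algebraMap_apply Fq[X] 𝒪[K] K a).symm

/-- If the coefficients of `c⁻¹ φ_X c` are integral and one of them, other than the constant one,
is a unit, then `φ` has stable reduction. -/
theorem hasStableReduction_of_scaling (φ : DrinfeldModule Fq K) (c : Kˣ)
    (hint : ∀ i, valuation K ((φ.toRingHom X).coeff i * (c : K) ^ (Nat.card Fq ^ i - 1)) ≤ 1)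
    {j : ℕ} (hj : 1 ≤ j)
    (hunit : valuation K ((φ.toRingHom X).coeff j * (c : K) ^ (Nat.card Fq ^ j - 1)) = 1) :
    φ.HasStableReduction := by
  have hinj : Function.Injective (algebraMap 𝒪[K] K) := Subtype.val_injective
  obtain ⟨φ', hφ'⟩ := TwistedPoly.exists_lift_ringHom hinj (φ.twist c).toRingHom
    (fun a n => by
      rcases Nat.eq_zero_or_pos n with rfl | hn
      · rw [(φ.twist c).coeff_zero]
        exact ⟨_, algebraMap_integer_apply _⟩
      · rw [coeff_C_eq_zero _ _ hn]
        exact zero_mem _)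
    (fun n => mem_range_algebraMap_integer.2 <| by
      change valuation K ((TwistedPoly.conj φ.toRingHom c X).coeff n) ≤ 1
      rw [TwistedPoly.coeff_conj]
      exact hint n)
  have hcoeff (a : Fq[X]) (n : ℕ) :
      ((φ.twist c).toRingHom a).coeff n = algebraMap 𝒪[K] K ((φ' a).coeff n) := by
    rw [← hφ', TwistedPoly.coeff_map]
  let θ := (TwistedPoly.map Fq (IsLocalRing.residue 𝒪[K])).comp φ'
  have hθ (a : Fq[X]) (n : ℕ) : (θ a).coeff n = IsLocalRing.residue 𝒪[K] ((φ' a).coeff n) := rfl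
  have hθC (a : Fq) (n : ℕ) (hn : 0 < n) : (θ (C a)).coeff n = 0 := by
    have h : (φ' (C a)).coeff n = 0 := hinj <| by
      rw [← hcoeff, coeff_C_eq_zero _ _ hn, map_zero]
    rw [hθ, h, map_zero]
  have hθj : (θ X).coeff j ≠ 0 := by
    rw [hθ, residue_ne_zero_iff]
    change valuation K (algebraMap 𝒪[K] K _) = 1
    rw [← hcoeff]
    change valuation K ((TwistedPoly.conj φ.toRingHom c X).coeff j) = 1
    rw [TwistedPoly.coeff_conj]
    exact hunit
  -- The rank of the reduction is the degree of the reduced polynomial. It may be smaller than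
  -- `φ.rank`, but it is at least `j ≥ 1`.
  obtain ⟨r, hjr, hr⟩ := TwistedPoly.exists_hasDegree hθj
  refine ⟨φ', φ.twist c, ⟨θ, r, hj.trans hjr, fun a => ?_, fun a n hn => ?_, hr.1⟩, hcoeff,
    φ.twist_isIsomorphic c, hθ⟩
  · have h : (φ' a).coeff 0 = algebraMap Fq[X] 𝒪[K] a := hinj <| by
      rw [← hcoeff, (φ.twist c).coeff_zero, algebraMap_integer_apply]
    rw [hθ, h]
    rfl
  · rcases eq_or_ne a 0 with rfl | ha
    · rw [map_zero, TwistedPoly.coeff_zero]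
    · exact (TwistedPoly.hasDegree_ringHom θ hθC (hj.trans hjr) hr ha).2 n hn

theorem _root_.TwistedPoly.exists_valuation_coeff_max {f : TwistedPoly Fq K} (hf : f ≠ 0) :
    ∃ i, f.coeff i ≠ 0 ∧ ∀ n, valuation K (f.coeff n) ≤ valuation K (f.coeff i) := by
  obtain ⟨j, hj⟩ := TwistedPoly.exists_coeff_ne_zero hf
  obtain ⟨i, -, hi⟩ := Finset.exists_max_image f.toFinsupp.support
    (fun n => valuation K (f.coeff n)) ⟨j, Finsupp.mem_support_iff.2 hj⟩
  have h (n : ℕ) : valuation K (f.coeff n) ≤ valuation K (f.coeff i) := by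
    by_cases hn : f.coeff n = 0
    · rw [hn, map_zero]
      exact zero_le
    · exact hi n (Finsupp.mem_support_iff.2 hn)
  refine ⟨i, fun h0 => ?_, h⟩
  have := h j
  rw [h0, map_zero, le_zero_iff, map_eq_zero] at this
  exact hj this

/-- A nonzero twisted polynomial over `K` becomes primitive after dividing by a coefficient. -/
theorem _root_.TwistedPoly.exists_primitive {f : TwistedPoly Fq K} (hf : f ≠ 0) :
    ∃ (c : Kˣ) (f₀ : TwistedPoly Fq 𝒪[K]),
      TwistedPoly.map Fq (algebraMap 𝒪[K] K) f₀ = TwistedPoly.C Fq (↑c⁻¹ : K) * f ∧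
      TwistedPoly.map Fq (IsLocalRing.residue 𝒪[K]) f₀ ≠ 0 ∧
      ∀ n, valuation K (f.coeff n) ≤ valuation K (c : K) := by
  obtain ⟨i, hi, hmax⟩ := TwistedPoly.exists_valuation_coeff_max hf
  have hv : valuation K (f.coeff i) ≠ 0 := by simpa using hi
  obtain ⟨f₀, hf₀⟩ := TwistedPoly.mem_range_map.2
    (show ∀ n, (TwistedPoly.C Fq (↑(Units.mk0 _ hi)⁻¹ : K) * f).coeff n ∈
        (algebraMap 𝒪[K] K).range from fun n => by
      rw [mem_range_algebraMap_integer, TwistedPoly.coeff_C_mul, map_mul, Units.val_inv_eq_inv_val,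
        Units.val_mk0, map_inv₀, inv_mul_le_one₀ (zero_lt_iff.2 hv)]
      exact hmax n)
  refine ⟨Units.mk0 _ hi, f₀, hf₀, fun h => ?_, hmax⟩
  have h1 := congrArg (fun g => TwistedPoly.coeff g i) h
  simp only [TwistedPoly.coeff_map, TwistedPoly.coeff_zero] at h1
  refine (residue_ne_zero_iff.2 ?_) h1
  change valuation K (algebraMap 𝒪[K] K _) = 1
  rw [← TwistedPoly.coeff_map, hf₀, TwistedPoly.coeff_C_mul, Units.val_inv_eq_inv_val,
    Units.val_mk0, inv_mul_cancel₀ hi, map_one]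

/-- Stable reduction is an isogeny invariant. -/
theorem HasStableReduction.of_isIsogeny {φ ψ : DrinfeldModule Fq K} {u : TwistedPoly Fq K}
    (h : φ.HasStableReduction) (hu : φ.IsIsogeny ψ u) : ψ.HasStableReduction := by
  obtain ⟨φ', φK, φbar, hφK, ⟨w, hw, hwφ⟩, hφbar⟩ := h
  obtain ⟨hu0, hu⟩ := hu
  set red := TwistedPoly.map Fq (IsLocalRing.residue 𝒪[K]) with hred
  set ι := TwistedPoly.map Fq (algebraMap 𝒪[K] K) with hι
  have hιinj : Function.Injective ι := TwistedPoly.map_injective Subtype.val_injective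
  have hφι : ι (φ' X) = φK.toRingHom X := TwistedPoly.ext_coeff fun n => (hφK X n).symm
  have hφred : red (φ' X) = φbar.toRingHom X := TwistedPoly.ext_coeff fun n => (hφbar X n).symm
  have huw : u * w ≠ 0 := fun h0 => hu0 ((hw.mul_left_eq_zero).1 h0)
  have hcomm : u * w * φK.toRingHom X = ψ.toRingHom X * (u * w) := by
    rw [mul_assoc, hwφ, ← mul_assoc, hu, mul_assoc]
  -- Scaling the isogeny to a primitive `U` costs only a conjugation of `ψ` by `c`.
  obtain ⟨c, U, hU, hUbar, -⟩ := TwistedPoly.exists_primitive huw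
  set P := TwistedPoly.conj ψ.toRingHom c X with hP
  have hPU : P * ι U = ι (U * φ' X) := by
    have hcc : TwistedPoly.C Fq (c : K) * TwistedPoly.C Fq (↑c⁻¹ : K) = 1 := by
      rw [← map_mul, Units.mul_inv, map_one]
    rw [map_mul, hU, hφι, mul_assoc _ (u * w), hcomm, hP, TwistedPoly.conj_apply]
    simp only [mul_assoc]
    rw [← mul_assoc (TwistedPoly.C Fq (c : K)), hcc, one_mul]
  have hP0 : P ≠ 0 := fun h0 => (ψ.twist c).coeff_rank_ne_zero (by
    change P.coeff _ = 0
    rw [h0, TwistedPoly.coeff_zero])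
  obtain ⟨e, Q, hQ, hQbar, hmax⟩ := TwistedPoly.exists_primitive hP0
  -- Gauss lemma: if `P` were not integral, its primitive multiple `Q = e⁻¹ P` would satisfy `Q U =
  -- e⁻¹ (U φ'_X)`, whose reduction vanishes, although `Q` and `U` both have nonzero reduction.
  have he : valuation K (e : K) ≤ 1 := by
    by_contra! he
    have hlt : valuation K (↑e⁻¹ : K) < 1 := by
      rw [Units.val_inv_eq_inv_val, map_inv₀]
      exact inv_lt_one_of_one_lt₀ he
    have h1 : Q * U = TwistedPoly.C Fq (⟨(↑e⁻¹ : K), hlt.le⟩ : 𝒪[K]) * (U * φ' X) := hιinj <| by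
      have h2 : ι (TwistedPoly.C Fq (⟨(↑e⁻¹ : K), hlt.le⟩ : 𝒪[K])) =
          TwistedPoly.C Fq (↑e⁻¹ : K) := TwistedPoly.ext_coeff fun n => by
        rw [hι, TwistedPoly.coeff_map, TwistedPoly.coeff_C, TwistedPoly.coeff_C]
        split_ifs <;> rfl
      rw [map_mul, hQ, mul_assoc, hPU, map_mul _ _ (U * φ' X), h2]
    refine TwistedPoly.mul_ne_zero_of_ne_zero hQbar hUbar ?_
    rw [← map_mul, h1, map_mul]
    have h3 : TwistedPoly.map Fq (IsLocalRing.residue 𝒪[K])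
        (TwistedPoly.C Fq (⟨(↑e⁻¹ : K), hlt.le⟩ : 𝒪[K])) = 0 := by
      refine TwistedPoly.ext_coeff fun n => ?_
      rw [TwistedPoly.coeff_map, TwistedPoly.coeff_C, TwistedPoly.coeff_zero]
      split_ifs
      · by_contra h4
        exact hlt.ne (residue_ne_zero_iff.1 h4)
      · exact map_zero _
    rw [h3, zero_mul]
  obtain ⟨P₀, hP₀⟩ := TwistedPoly.mem_range_map.2
    (show ∀ n, P.coeff n ∈ (algebraMap 𝒪[K] K).range from fun n =>
      mem_range_algebraMap_integer.2 ((hmax n).trans he))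
  have hred_eq : red P₀ * red U = red U * φbar.toRingHom X := by
    have h1 : P₀ * U = U * φ' X := hιinj <| by rw [map_mul, hP₀, hPU]
    rw [← map_mul, h1, map_mul, hφred]
  obtain ⟨i, hi⟩ := TwistedPoly.exists_coeff_ne_zero hUbar
  obtain ⟨m, -, hm⟩ := TwistedPoly.exists_hasDegree hi
  -- Comparing degrees in `P̄ Ū = Ū φ̄_X` gives `P̄` the rank of `φbar` as degree, so its leading
  -- coefficient is a unit beyond the constant term.
  have hdeg := hm.mul φbar.hasDegree_X
  rw [← hred_eq] at hdeg
  have hP₀bar : red P₀ ≠ 0 := fun h0 => hdeg.1 (by rw [h0, zero_mul, TwistedPoly.coeff_zero])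
  obtain ⟨i', hi'⟩ := TwistedPoly.exists_coeff_ne_zero hP₀bar
  obtain ⟨s, -, hs⟩ := TwistedPoly.exists_hasDegree hi'
  have hsr := (hs.mul hm).unique hdeg
  have hs1 : 1 ≤ s := by
    have := φbar.one_le_rank
    omega
  refine ψ.hasStableReduction_of_scaling c (fun n => ?_) hs1 ?_
  · rw [← TwistedPoly.coeff_conj]
    exact (hmax n).trans he
  · rw [← TwistedPoly.coeff_conj, ← hP, ← hP₀, TwistedPoly.coeff_map]
    exact residue_ne_zero_iff.1 hs.1

end DrinfeldModule

/-! ### Integral extensions of complete local rings with finite residue field -/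

section Complete

universe v

/-- A finite module over a complete Noetherian ring is complete. -/
theorem IsAdicComplete.of_finite {R : Type v} [CommRing R] [IsNoetherianRing R] (I : Ideal R)
    [IsAdicComplete I R] (M : Type v) [AddCommGroup M] [Module R M] [Module.Finite R M] :
    IsAdicComplete I M := by
  rw [← AdicCompletion.of_bijective_iff]
  have h1 := AdicCompletion.ofTensorProduct_bijective_of_finite_of_isNoetherian I M
  let e := (TensorProduct.lid R M).symm.trans
    (LinearEquiv.rTensor M (AdicCompletion.ofLinearEquiv I R))
  have h2 : ⇑(AdicCompletion.of I M) = AdicCompletion.ofTensorProduct I M ∘ e := by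
    ext1 x
    have : e x = (AdicCompletion.of I R 1) ⊗ₜ[R] x := rfl
    rw [Function.comp_apply, this, AdicCompletion.ofTensorProduct_tmul]
    have h3 : AdicCompletion.of I R 1 = 1 := rfl
    rw [h3, one_smul]
  rw [h2]
  exact h1.comp e.bijective

/-- The powers of `x` are eventually periodic; an exponent that is a multiple of the period and lies
beyond the preperiod gives an idempotent. -/
theorem exists_isIdempotentElem_pow {M : Type*} [Monoid M] [Finite M] (x : M) :
    ∃ n, n ≠ 0 ∧ IsIdempotentElem (x ^ n) := by
  obtain ⟨i, j, hij, h⟩ := Finite.exists_ne_map_eq_of_infinite (fun n : ℕ => x ^ n)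
  wlog hlt : i < j generalizing i j
  · exact this j i hij.symm h.symm (by omega)
  have h1 (t k : ℕ) (hk : i ≤ k) : x ^ (k + t * (j - i)) = x ^ k := by
    induction t with
    | zero => simp
    | succ t ih =>
      have e1 : k + (t + 1) * (j - i) = j + (k - i + t * (j - i)) := by
        rw [add_mul, one_mul]
        omega
      have e2 : k + t * (j - i) = i + (k - i + t * (j - i)) := by omega
      rw [e1, pow_add, show x ^ j = x ^ i from h.symm, ← pow_add, ← e2, ih]
  have hpos : 0 < j - i := by omega
  -- A multiple of the period `j - i` that is at least `i`; the `+ 1` keeps it nonzero when `i = 0`.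
  refine ⟨(i + 1) * (j - i), by positivity, ?_⟩
  rw [IsIdempotentElem, ← pow_add]
  exact h1 _ _ (by nlinarith)

/-- An integral domain which is integral over a complete local Noetherian ring with finite residue
field is local. -/
theorem IsLocalRing.of_isIntegral_of_isAdicComplete {R B : Type v} [CommRing R] [IsNoetherianRing R]
    (I : Ideal R) [IsAdicComplete I R] [Finite (R ⧸ I)] [CommRing B] [IsDomain B] [Algebra R B]
    [Algebra.IsIntegral R B] : IsLocalRing B := by
  refine IsLocalRing.of_isUnit_or_isUnit_one_sub_self fun x => ?_
  -- `B` need not be finite over `R`, but `R[x]` is, hence it is complete and has a finite quotient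
  -- by `J`.
  let S := Algebra.adjoin R {x}
  have hfin : Module.Finite R S :=
    Module.Finite.iff_fg.2 (Algebra.IsIntegral.isIntegral (R := R) x).fg_adjoin_singleton
  let J := I.map (algebraMap R S)
  have hcomplete : IsAdicComplete J S :=
    (IsAdicComplete.map_algebraMap_iff I S).2 (IsAdicComplete.of_finite I S)
  have hquot : Finite (S ⧸ J) := by
    have : Module.Finite (R ⧸ I) (S ⧸ J) := Module.Finite.of_restrictScalars_finite R (R ⧸ I) _
    exact Module.finite_of_finite (R ⧸ I)
  let y : S := ⟨x, Algebra.self_mem_adjoin_singleton R x⟩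
  have hyx (n : ℕ) : ((y ^ n : S) : B) = x ^ n := rfl
  have hunit (z : S) (hz : z ∈ J) : IsUnit (1 - (z : B)) := by
    have h1 := IsAdicComplete.le_jacobson_bot J hz
    have h2 := (Ideal.mem_jacobson_bot.1 h1 (-1)).map S.val
    rw [map_add, map_mul, map_neg, map_one] at h2
    convert h2 using 1
    change 1 - (z : B) = z * -1 + 1
    ring
  obtain ⟨n, hn, hidem⟩ := exists_isIdempotentElem_pow (Ideal.Quotient.mk J y)
  -- Hensel lifts the idempotent class of `y^n`: the derivative `2e - 1` of `X^2 - X` at an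
  -- idempotent `e` squares to `1`. In the domain `B` the lift is `0` or `1`, making `1 - x^n` or
  -- `x^n` a unit.
  obtain ⟨a, ha, hay⟩ := HenselianRing.is_henselian (I := J) (X ^ 2 - X : S[X])
    (by monicity!) (y ^ n)
    (by
      rw [← Ideal.Quotient.eq_zero_iff_mem]
      simp only [eval_sub, eval_pow, eval_X, map_sub, map_pow]
      rw [sub_eq_zero, pow_two]
      exact hidem)
    (by
      have h : Ideal.Quotient.mk J (eval (y ^ n) (derivative (X ^ 2 - X : S[X]))) =
          2 * (Ideal.Quotient.mk J y ^ n) - 1 := by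
        simp
        ring
      rw [h]
      refine IsUnit.of_mul_eq_one (2 * (Ideal.Quotient.mk J y ^ n) - 1) ?_
      linear_combination 4 * hidem.eq)
  have ha' : a * (a - 1) = 0 := by
    have : a ^ 2 - a = 0 := by simpa [IsRoot] using ha
    linear_combination this
  rcases mul_eq_zero.1 ha' with h0 | h1
  · right
    rw [h0, zero_sub] at hay
    have h2 := hunit _ (neg_mem hay)
    rw [neg_neg, hyx] at h2
    exact isUnit_of_dvd_unit (one_sub_dvd_one_sub_pow x n) h2
  · left
    rw [sub_eq_zero.1 h1] at hay
    have h2 := hunit _ hay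
    have h3 : 1 - (((1 - y ^ n : S)) : B) = x ^ n := by
      change 1 - (1 - x ^ n) = x ^ n
      ring
    rw [h3] at h2
    exact (isUnit_pow_iff hn).1 h2

end Complete

/-! ### The integral closure in the separable closure, and inertia -/

section LocalField

variable (K : Type*) [Field K] [ValuativeRel K] [TopologicalSpace K] [IsNonarchimedeanLocalField K]

instance isLocalRing_integralClosure_separableClosure :
    IsLocalRing (integralClosure 𝒪[K] (SeparableClosure K)) := by
  let := IsTopologicalAddGroup.rightUniformSpace K
  have := isUniformAddGroup_of_addCommGroup (G := K)
  have : Finite (𝒪[K] ⧸ 𝓂[K]) := inferInstanceAs (Finite 𝓀[K])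
  exact IsLocalRing.of_isIntegral_of_isAdicComplete 𝓂[K]

/-- An element of the Galois group is in the inertia group if and only if it acts trivially on the
residue field of the integral closure. -/
theorem mem_inertiaGroup_iff (σ : Gal(SeparableClosure K/K)) :
    σ ∈ inertiaGroup K ↔ ∀ x : integralClosure 𝒪[K] (SeparableClosure K),
      σ • x - x ∈ IsLocalRing.maximalIdeal (integralClosure 𝒪[K] (SeparableClosure K)) := by
  rw [inertiaGroup, IsLocalRing.jacobson_eq_maximalIdeal ⊥ bot_ne_top]
  rfl

end LocalField

/-! ### Monic polynomials over integrally closed rings -/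

/-- A monic polynomial over a ring `B`, integrally closed in the field `L`, which splits in `L`
already splits over `B`. -/
theorem Polynomial.Monic.exists_eq_prod_of_splits {B L : Type*} [CommRing B] [Field L] [Algebra B L]
    [IsIntegrallyClosedIn B L] {P : B[X]} (hP : P.Monic) (hs : (P.map (algebraMap B L)).Splits) :
    ∃ s : Multiset B, P = (s.map fun y => X - C y).prod := by
  have hroot (x : L) (hx : x ∈ (P.map (algebraMap B L)).roots) : ∃ y : B, algebraMap B L y = x := by
    rw [← IsIntegrallyClosedIn.isIntegral_iff (R := B)]
    refine ⟨P, hP, ?_⟩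
    rw [← eval_map]
    exact isRoot_of_mem_roots hx
  obtain ⟨s, hs'⟩ : ∃ s : Multiset B, s.map (algebraMap B L) = (P.map (algebraMap B L)).roots := by
    generalize (P.map (algebraMap B L)).roots = t at hroot
    induction t using Multiset.induction_on with
    | empty => exact ⟨0, rfl⟩
    | cons a t ih =>
      obtain ⟨s, hs⟩ := ih fun x hx => hroot x (Multiset.mem_cons_of_mem hx)
      obtain ⟨y, hy⟩ := hroot a (Multiset.mem_cons_self a t)
      exact ⟨y ::ₘ s, by rw [Multiset.map_cons, hs, hy]⟩
  refine ⟨s, map_injective _ (IsIntegralClosure.algebraMap_injective B B L) ?_⟩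
  rw [hs.eq_prod_roots_of_monic (hP.map _), ← hs', Polynomial.map_multiset_prod, Multiset.map_map,
    Multiset.map_map]
  congr 1
  refine Multiset.map_congr rfl fun y _ => ?_
  simp

/-! ### Inertia and roots of unity -/

/-- The field `k(x)` is finite, and the order of its unit group is `-1` in `F`. -/
theorem exists_pow_eq_one_of_isIntegralElem {k F : Type*} [Field k] [Finite k] [Field F]
    {f : k →+* F} {x : F} (hx : f.IsIntegralElem x) (hx0 : x ≠ 0) :
    ∃ m : ℕ, (m : F) ≠ 0 ∧ x ^ m = 1 := by
  let := f.toAlgebra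
  have hxi : IsIntegral k x := hx
  have := IntermediateField.adjoin.finiteDimensional hxi
  have : Finite (IntermediateField.adjoin k {x}) := Module.finite_of_finite k
  let := Fintype.ofFinite (IntermediateField.adjoin k {x})
  refine ⟨Fintype.card (IntermediateField.adjoin k {x}) - 1, ?_, ?_⟩
  · rw [Nat.cast_sub Fintype.card_pos, Nat.cast_one]
    have h : ((Fintype.card (IntermediateField.adjoin k {x}) : ℕ) : F) = 0 := by
      have := congrArg (algebraMap (IntermediateField.adjoin k {x}) F)
        (FiniteField.cast_card_eq_zero (IntermediateField.adjoin k {x}))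
      rwa [map_natCast, map_zero] at this
    rw [h, zero_sub]
    exact neg_ne_zero.2 one_ne_zero
  · have h := FiniteField.pow_card_sub_one_eq_one (K := IntermediateField.adjoin k {x})
      ⟨x, IntermediateField.mem_adjoin_simple_self k x⟩ (fun h => hx0 (congrArg Subtype.val h))
    exact congrArg Subtype.val h

section IntegralClosure

variable {R L : Type*} [CommRing R] [IsLocalRing R] [Finite (IsLocalRing.ResidueField R)] [Field L]
  [Algebra R L] [FaithfulSMul R L] [IsLocalRing (integralClosure R L)]

/-- The residue field of the integral closure is algebraic over a finite field, so every nonzero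
residue is a root of unity of order prime to the characteristic. -/
theorem exists_pow_sub_one_mem_maximalIdeal {x : integralClosure R L} (hx : IsUnit x) :
    ∃ m : ℕ, (m : L) ≠ 0 ∧
      x ^ m - 1 ∈ IsLocalRing.maximalIdeal (integralClosure R L) := by
  let res := IsLocalRing.residue (integralClosure R L)
  have hloc : IsLocalHom (algebraMap R (integralClosure R L)) :=
    RingHom.IsIntegral.isLocalHom (fun x => Algebra.IsIntegral.isIntegral x) fun a b h =>
      FaithfulSMul.algebraMap_injective R L (congrArg Subtype.val h)
  have hker : ∀ a ∈ IsLocalRing.maximalIdeal R,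
      (res.comp (algebraMap R (integralClosure R L))) a = 0 := by
    intro a ha
    rw [RingHom.comp_apply, IsLocalRing.residue_eq_zero_iff]
    exact fun h => ha (hloc.map_nonunit a h)
  let f : IsLocalRing.ResidueField R →+* IsLocalRing.ResidueField (integralClosure R L) :=
    Ideal.Quotient.lift _ _ hker
  have hf : f.comp (IsLocalRing.residue R) =
      res.comp (algebraMap R (integralClosure R L)) := Ideal.Quotient.lift_comp_mk _ _ hker
  have hint : (f.comp (IsLocalRing.residue R)).IsIntegralElem (res x) := by
    rw [hf]
    exact RingHom.IsIntegralElem.map (Algebra.IsIntegral.isIntegral (R := R) x) res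
  obtain ⟨m, hm, hxm⟩ := exists_pow_eq_one_of_isIntegralElem hint.of_comp
    ((IsLocalRing.residue_ne_zero_iff_isUnit x).2 hx)
  refine ⟨m, fun h => hm ?_, ?_⟩
  · have h1 : ((m : ℕ) : integralClosure R L) = 0 := Subtype.ext (by simpa using h)
    rw [← map_natCast res, h1, map_zero]
  · rw [← IsLocalRing.residue_eq_zero_iff, map_sub, map_pow, map_one, sub_eq_zero]
    exact hxm

/-- Every unit of the integral closure is congruent to a root of unity. -/
theorem exists_rootOfUnity_congr [IsSepClosed L] {x : integralClosure R L} (hx : IsUnit x) :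
    ∃ (m : ℕ) (ζ : integralClosure R L), (m : L) ≠ 0 ∧ ζ ^ m = 1 ∧
      x - ζ ∈ IsLocalRing.maximalIdeal (integralClosure R L) := by
  obtain ⟨m, hm, hxm⟩ := exists_pow_sub_one_mem_maximalIdeal hx
  have hm0 : m ≠ 0 := by
    rintro rfl
    simp at hm
  have hP : (X ^ m - C 1 : (integralClosure R L)[X]).Monic := monic_X_pow_sub_C _ hm0
  obtain ⟨s, hs⟩ := hP.exists_eq_prod_of_splits (L := L) (by
    rw [Polynomial.map_sub, Polynomial.map_pow, map_X, map_C, map_one]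
    exact IsSepClosed.splits_of_separable _ (separable_X_pow_sub_C 1 hm one_ne_zero))
  -- The product of the `x - y` over the `m`-th roots of unity `y` lies in a prime ideal, so one
  -- factor does.
  have h1 : x ^ m - 1 = (s.map fun y => x - y).prod := by
    have := congrArg (eval x) hs
    simpa [eval_multiset_prod, Multiset.map_map] using this
  rw [h1] at hxm
  obtain ⟨_, hw, hxy⟩ := ((IsLocalRing.maximalIdeal.isMaximal
    (integralClosure R L)).isPrime.multiset_prod_mem_iff_exists_mem _).1 hxm
  obtain ⟨y, hy, rfl⟩ := Multiset.mem_map.1 hw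
  refine ⟨m, y, hm, ?_, hxy⟩
  have h2 := congrArg (eval y) hs
  rw [eval_multiset_prod, Multiset.map_map, Multiset.prod_eq_zero
    (Multiset.mem_map.2 ⟨y, hy, by simp⟩)] at h2
  simpa [sub_eq_zero] using h2

end IntegralClosure

/-! ### Fields generated by roots of unity -/

/-- A Kummer generator `c` of a field generated by roots of unity differs from an element of the
base field by a root of unity. -/
theorem exists_algebraMap_eq_mul_of_adjoin_rootsOfUnity {K E : Type*} [Field K] [Field E]
    [Algebra K E] [FiniteDimensional K E] [IsGalois K E] (p : ℕ) [Fact p.Prime] [CharP E p]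
    {m n : ℕ} [NeZero m] (hm : p.Coprime m) (hnm : n ∣ m)
    (hgen : ∀ σ τ : Gal(E/K), (∀ ζ : E, ζ ^ m = 1 → σ ζ = τ ζ) → σ = τ)
    {c : E} (hc0 : c ≠ 0) {g : K} (hc : c ^ n = algebraMap K E g) :
    ∃ (d : K) (z : E) (s : ℕ), 0 < s ∧ z ^ s = 1 ∧ algebraMap K E d = c * z := by
  let f (σ : Gal(E/K)) : rootsOfUnity m E →* E :=
    ((σ : E →+* E) : E →* E).comp ((Units.coeHom E).comp (rootsOfUnity m E).subtype)
  have hf : Function.Injective f := fun σ τ h => hgen σ τ fun ζ hζ =>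
    DFunLike.congr_fun h (rootsOfUnity.mkOfPowEq ζ hζ)
  -- Distinct automorphisms restrict to distinct characters of the `m`-th roots of unity. Dedekind
  -- independence then yields `b` for which the trace of `c * b` is nonzero; this trace is `d`.
  have hli := (linearIndependent_monoidHom (rootsOfUnity m E) E).comp f hf
  obtain ⟨b, hb⟩ : ∃ b : rootsOfUnity m E, ∑ σ : Gal(E/K), σ c * σ ((b : Eˣ) : E) ≠ 0 := by
    by_contra! h
    have h1 := Fintype.linearIndependent_iff.1 hli (fun σ => σ c) (funext fun b => by
      rw [Finset.sum_apply]
      exact h b) 1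
    exact hc0 (by simpa using h1)
  have htr : algebraMap K E (Algebra.trace K E (c * ((b : Eˣ) : E))) =
      ∑ σ : Gal(E/K), σ c * σ ((b : Eˣ) : E) := by
    rw [trace_eq_sum_automorphisms]
    simp only [map_mul]
  have hbm : ((b : Eˣ) : E) ^ m = 1 := by
    have := b.2
    rw [mem_rootsOfUnity'] at this
    exact this
  have hterm (σ : Gal(E/K)) : (σ c * σ ((b : Eˣ) : E) / c) ^ m = 1 := by
    have h1 : σ c ^ m = c ^ m := by
      obtain ⟨e, rfl⟩ := hnm
      rw [pow_mul, pow_mul, ← map_pow, hc, AlgEquiv.commutes]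
    rw [div_pow, mul_pow, h1, ← map_pow, hbm, map_one, mul_one, div_self (pow_ne_zero m hc0)]
  -- A power of `p` congruent to `1` modulo `m`: raising to the power `N` is additive and fixes
  -- `m`-th roots of unity. So it fixes their sum `z`, and a nonzero `z` is itself a root of unity.
  let N := p ^ m.totient
  have hN : 1 < N := Nat.one_lt_pow (Nat.totient_pos.2 (NeZero.pos m)).ne'
    (Fact.out : p.Prime).one_lt
  have hmN : m ∣ N - 1 := (Nat.modEq_iff_dvd' hN.le).1 (Nat.ModEq.pow_totient hm).symm
  have hterm' (σ : Gal(E/K)) :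
      (σ c * σ ((b : Eˣ) : E) / c) ^ N = σ c * σ ((b : Eˣ) : E) / c := by
    obtain ⟨e, he⟩ := hmN
    have hN' : N = m * e + 1 := by omega
    rw [hN', pow_succ, pow_mul, hterm, one_pow, one_mul]
  set z : E := (∑ σ : Gal(E/K), σ c * σ ((b : Eˣ) : E)) / c with hz
  have hz0 : z ≠ 0 := div_ne_zero hb hc0
  have hzN : z ^ N = z := by
    rw [hz, Finset.sum_div, sum_pow_char_pow]
    exact Finset.sum_congr rfl fun σ _ => hterm' σ
  refine ⟨_, z, N - 1, by omega, ?_, htr.trans (by rw [hz, mul_div_cancel₀ _ hc0])⟩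
  have h1 : z ^ (N - 1) * z = 1 * z := by
    rw [← pow_succ, Nat.sub_add_cancel hN.le, hzN, one_mul]
  exact mul_right_cancel₀ hz0 h1

/-! ### Elements fixed by inertia -/

section LocalField

variable {K : Type*} [Field K] [ValuativeRel K] [TopologicalSpace K] [IsNonarchimedeanLocalField K]

/-- Every unit is congruent to such a root of unity (`exists_rootOfUnity_congr`), so these determine
the action on residues; non-units stay in the maximal ideal. -/
theorem mem_inertiaGroup_of_fixes_rootsOfUnity {σ : Gal(SeparableClosure K/K)}
    (h : ∀ (m : ℕ) (ζ : SeparableClosure K), (m : SeparableClosure K) ≠ 0 → ζ ^ m = 1 → σ ζ = ζ) :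
    σ ∈ inertiaGroup K := by
  rw [mem_inertiaGroup_iff]
  intro x
  have hsmul {y : integralClosure 𝒪[K] (SeparableClosure K)}
      (hy : y ∈ IsLocalRing.maximalIdeal _) : σ • y ∈ IsLocalRing.maximalIdeal _ := by
    intro hu
    have := hu.map (MulSemiringAction.toRingHom Gal(SeparableClosure K/K)
      (integralClosure 𝒪[K] (SeparableClosure K)) σ⁻¹)
    rw [MulSemiringAction.toRingHom_apply, inv_smul_smul] at this
    exact hy this
  have : FaithfulSMul 𝒪[K] (SeparableClosure K) := by
    rw [faithfulSMul_iff_algebraMap_injective]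
    exact (algebraMap K (SeparableClosure K)).injective.comp Subtype.val_injective
  by_cases hx : IsUnit x
  · obtain ⟨m, ζ, hm, hζ, hxζ⟩ := exists_rootOfUnity_congr hx
    have hσζ : σ • ζ = ζ := Subtype.ext (h m ζ hm (by exact_mod_cast congrArg Subtype.val hζ))
    have h1 := sub_mem (hsmul hxζ) hxζ
    rwa [smul_sub, hσζ, sub_sub_sub_cancel_right] at h1
  · exact sub_mem (hsmul hx) hx

/-- By the Galois correspondence: an automorphism fixing all these roots of unity belongs to
inertia, hence fixes `c`. -/
theorem mem_adjoin_rootsOfUnity_of_inertia_fixed {c : SeparableClosure K}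
    (hc : ∀ σ ∈ inertiaGroup K, σ c = c) :
    c ∈ IntermediateField.adjoin K
      {ζ : SeparableClosure K | ∃ m : ℕ, (m : SeparableClosure K) ≠ 0 ∧ ζ ^ m = 1} := by
  rw [← InfiniteGalois.fixedField_fixingSubgroup (IntermediateField.adjoin K _),
    IntermediateField.mem_fixedField_iff]
  intro σ hσ
  rw [IntermediateField.mem_fixingSubgroup_iff] at hσ
  exact hc σ (mem_inertiaGroup_of_fixes_rootsOfUnity fun m ζ hm hζ =>
    hσ ζ (IntermediateField.subset_adjoin _ _ ⟨m, hm, hζ⟩))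

theorem exists_mem_adjoin_pow_eq_one {K L : Type*} [Field K] [Field L] [Algebra K L] {c : L}
    (hc : c ∈ IntermediateField.adjoin K {ζ : L | ∃ m : ℕ, (m : L) ≠ 0 ∧ ζ ^ m = 1}) :
    ∃ m : ℕ, (m : L) ≠ 0 ∧ c ∈ IntermediateField.adjoin K {ζ : L | ζ ^ m = 1} := by
  obtain ⟨T, hT, hcT⟩ := IntermediateField.exists_finset_of_mem_adjoin hc
  have hT' : ∀ ζ ∈ T, ∃ m : ℕ, (m : L) ≠ 0 ∧ ζ ^ m = 1 := fun ζ hζ => hT hζ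
  choose! m hm using hT'
  refine ⟨∏ ζ ∈ T, m ζ, ?_, IntermediateField.adjoin.mono K _ _ (fun ζ hζ => ?_) hcT⟩
  · rw [Nat.cast_prod]
    exact Finset.prod_ne_zero_iff.2 fun ζ hζ => (hm ζ hζ).1
  · obtain ⟨e, he⟩ := Finset.dvd_prod_of_mem m hζ
    change ζ ^ _ = 1
    rw [he, pow_mul, (hm ζ hζ).2, one_pow]

/-- If a root `c` of `X ^ n - g⁻¹`, with `n` prime to the characteristic, is contained in a field
generated by roots of unity, then `g` is an `n`-th power up to a root of unity. -/
theorem exists_pow_mul_pow_eq_one {K L : Type*} [Field K] [Field L] [Algebra K L] [IsSepClosed L]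
    [Algebra.IsSeparable K L] (p : ℕ) [Fact p.Prime] [CharP K p] {c : L} {n : ℕ} (hn : (n : L) ≠ 0)
    {g : K} (hg : g ≠ 0) (hcg : c ^ n = algebraMap K L g⁻¹) {m₀ : ℕ} (hm₀ : (m₀ : L) ≠ 0)
    (hcm₀ : c ∈ IntermediateField.adjoin K {ζ : L | ζ ^ m₀ = 1}) :
    ∃ (d : K) (s : ℕ), d ≠ 0 ∧ s ≠ 0 ∧ (d ^ n * g) ^ s = 1 := by
  have hn0 : n ≠ 0 := by
    rintro rfl
    simp at hn
  have hc0 : c ≠ 0 := by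
    rintro rfl
    rw [zero_pow hn0, eq_comm, map_eq_zero] at hcg
    exact inv_ne_zero hg hcg
  -- The factor `m₀` puts `c` in the field of `m`-th roots of unity; the factor `n` makes each `σ c
  -- / c` an `m`-th root of unity.
  set m := n * m₀ with hmdef
  have hm : (m : L) ≠ 0 := by
    rw [hmdef, Nat.cast_mul]
    exact mul_ne_zero hn hm₀
  have hm0 : m ≠ 0 := by
    intro h
    rw [h] at hm
    simp at hm
  have : NeZero m := ⟨hm0⟩
  have : CharP L p := charP_of_injective_algebraMap (algebraMap K L).injective p
  have hpm : p.Coprime m := by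
    rw [Nat.Prime.coprime_iff_not_dvd Fact.out, ← CharP.cast_eq_zero_iff L p]
    exact hm
  let P : K[X] := X ^ m - C 1
  let E := IntermediateField.adjoin K (P.rootSet L)
  have hP0 : P ≠ 0 := X_pow_sub_C_ne_zero (Nat.pos_of_ne_zero hm0) 1
  have hmem (ζ : L) : ζ ∈ P.rootSet L ↔ ζ ^ m = 1 := by
    rw [mem_rootSet_of_ne hP0]
    simp [P, sub_eq_zero]
  have hcE : c ∈ E := by
    refine IntermediateField.adjoin.mono K _ _ (fun ζ (hζ : ζ ^ m₀ = 1) => ?_) hcm₀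
    rw [hmem, hmdef, mul_comm, pow_mul, hζ, one_pow]
  have hsplit : (P.map (algebraMap K L)).Splits := by
    have : P.map (algebraMap K L) = X ^ m - C 1 := by simp [P]
    rw [this]
    exact IsSepClosed.splits_of_separable _ (separable_X_pow_sub_C 1 hm one_ne_zero)
  have := IntermediateField.adjoin_rootSet_isSplittingField hsplit
  have : FiniteDimensional K E := IsSplittingField.finiteDimensional E P
  have : Normal K E := Normal.of_isSplittingField P
  have : IsGalois K E := ⟨⟩
  have : CharP E p := charP_of_injective_algebraMap (algebraMap K E).injective p
  have hcg' : (⟨c, hcE⟩ : E) ^ n = algebraMap K E g⁻¹ := Subtype.ext hcg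
  have hc0' : (⟨c, hcE⟩ : E) ≠ 0 := fun h => hc0 (congrArg Subtype.val h)
  obtain ⟨d, z, s, hs, hz, hd⟩ := exists_algebraMap_eq_mul_of_adjoin_rootsOfUnity (K := K) (E := E)
    p hpm (Dvd.intro m₀ rfl) (fun σ τ h => by
      have h1 : (σ : E →ₐ[K] E) = τ := IntermediateField.algHom_ext_of_eq_adjoin K rfl
        fun x hx => h _ (Subtype.ext ((hmem x).1 hx))
      exact AlgEquiv.ext fun x => DFunLike.congr_fun h1 x) hc0' hcg'
  have hz0 : z ≠ 0 := by
    rintro rfl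
    rw [zero_pow hs.ne'] at hz
    exact zero_ne_one hz
  refine ⟨d, s, ?_, hs.ne', ?_⟩
  · rintro rfl
    rw [map_zero, eq_comm] at hd
    exact mul_ne_zero hc0' hz0 hd
  · have h1 : algebraMap K E (d ^ n * g) = z ^ n := by
      rw [map_mul, map_pow, hd, mul_pow, hcg', mul_right_comm, ← map_mul, inv_mul_cancel₀ hg,
        map_one, one_mul]
    refine (algebraMap K E).injective ?_
    rw [map_pow, h1, ← pow_mul, mul_comm, pow_mul, hz, one_pow, map_one]

/-- If a root `c` of `X ^ n - g⁻¹`, with `n` prime to the characteristic, is fixed by inertia,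
then the valuation of `g` is an `n`-th power. -/
theorem exists_valuation_pow_mul_eq_one (p : ℕ) [Fact p.Prime] [CharP K p]
    {c : SeparableClosure K} {n : ℕ} (hn : (n : SeparableClosure K) ≠ 0) {g : K} (hg : g ≠ 0)
    (hcg : c ^ n = algebraMap K (SeparableClosure K) g⁻¹)
    (hc : ∀ σ ∈ inertiaGroup K, σ c = c) :
    ∃ d : K, d ≠ 0 ∧ valuation K (d ^ n * g) = 1 := by
  obtain ⟨m₀, hm₀, hcm₀⟩ := exists_mem_adjoin_pow_eq_one
    (mem_adjoin_rootsOfUnity_of_inertia_fixed hc)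
  obtain ⟨d, s, hd, hs, h⟩ := exists_pow_mul_pow_eq_one p hn hg hcg hm₀ hcm₀
  refine ⟨d, hd, ?_⟩
  have h3 := congrArg (valuation K) h
  rw [map_pow, map_one] at h3
  exact (pow_eq_one_iff_of_nonneg zero_le hs).1 h3

end LocalField

/-! ### Tate modules and unipotent automorphisms -/

namespace TateModule

variable {A : Type*} [CommRing A] {l : A} {M : Type*} [AddCommGroup M] [Module A M]

theorem pow_smul_add (x : TateModule l M) (n m : ℕ) : l ^ n • x.1 (m + n) = x.1 m := by
  induction n with
  | zero => simp
  | succ n ih => rw [pow_succ, mul_smul, ← add_assoc, x.2.2, ih]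

/-- Divisibility by `l` allows successive preimages above `x`; the recursion places `0` at index `0`
and `x` at index `1`. -/
theorem exists_apply_one_eq (hsurj : ∀ x : M, ∃ y : M, l • y = x) {x : M} (hx : l • x = 0) :
    ∃ t : TateModule l M, t.1 1 = x := by
  choose f hf using hsurj
  refine ⟨⟨fun n => Nat.rec 0 (fun k y => if k = 0 then x else f y) n, rfl, fun n => ?_⟩, rfl⟩
  rcases Nat.eq_zero_or_pos n with rfl | hn
  · exact hx
  · change l • (if n = 0 then x else f _) = _
    rw [if_neg hn.ne', hf]

/-- The Tate module at a prime of a principal ideal domain is torsion free. -/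
theorem eq_zero_of_smul_eq_zero [IsDomain A] [IsPrincipalIdealRing A] (hl : Prime l)
    {s : AdicCompletion (Ideal.span {l}) A} (hs : s ≠ 0) {t : TateModule l M} (h : s • t = 0) :
    t = 0 := by
  obtain ⟨b, rfl⟩ := AdicCompletion.mk_surjective _ _ s
  obtain ⟨n, hn⟩ : ∃ n, ¬ l ^ n ∣ b n := by
    by_contra! hb
    refine hs (AdicCompletion.ext_evalₐ fun n => ?_)
    rw [AdicCompletion.evalₐ_mk, map_zero, Ideal.Quotient.eq_zero_iff_mem,
      Ideal.span_singleton_pow, Ideal.mem_span_singleton]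
    exact hb n
  refine Subtype.ext (funext fun m => ?_)
  have hnm : ¬ l ^ n ∣ b (m + n) := by
    have h1 := AdicCompletion.Ideal.mk_eq_mk (Ideal.span {l}) (Nat.le_add_left n m) b
    rw [Ideal.Quotient.eq, Ideal.span_singleton_pow, Ideal.mem_span_singleton] at h1
    intro h2
    exact hn ((dvd_sub_right h2).1 h1)
  have hzero : b (m + n) • t.1 (m + n) = 0 := by
    rw [← completion_smul_apply _ t (m + n) (AdicCompletion.evalₐ_mk _ _ b), h]
    rfl
  have hb0 : b (m + n) ≠ 0 := fun h0 => hnm (h0 ▸ dvd_zero _)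
  -- Write `b (m + n) = l^k * b'` with `k ≤ n`. As `b'` is invertible modulo `l^(m + n)`, already
  -- `l^k` kills `t.1 (m + n)`, and hence so does `l^n`, which sends it to `t.1 m`.
  obtain ⟨b', hk, hb'⟩ :=
    (FiniteMultiplicity.of_prime_left hl hb0).exists_eq_pow_mul_and_not_dvd
  generalize multiplicity l (b (m + n)) = k at hk
  have hkn : k ≤ n := by
    by_contra! hlt
    exact hnm (hk ▸ (pow_dvd_pow l hlt.le).mul_right b')
  obtain ⟨e, a, hea⟩ := ((hl.irreducible.coprime_iff_not_dvd).2 hb').pow_left (m := m + n)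
  have h3 : l ^ k • t.1 (m + n) = 0 := by
    have h4 : l ^ k = (e * l ^ k) * l ^ (m + n) + a * (l ^ k * b') := by
      linear_combination (-l ^ k) * hea
    rw [h4, add_smul, mul_smul, pow_smul_apply, smul_zero, zero_add, ← hk, mul_smul, hzero,
      smul_zero]
  rw [← pow_smul_add t n m, ← Nat.sub_add_cancel hkn, pow_add, mul_smul]
  rw [Nat.sub_add_cancel hkn, h3, smul_zero]
  rfl

/-- Torsion-freeness of the Tate module: nothing dies in passing to the fraction field, so
identities on `V_l` descend to torsion points. -/
theorem one_tmul_injective [IsDomain A] [IsPrincipalIdealRing A] (hl : Prime l) :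
    Function.Injective fun t : TateModule l M =>
      ((1 : FractionRing (AdicCompletion (Ideal.span {l}) A)) ⊗ₜ t : RationalTateModule l M) := by
  have : Nontrivial (AdicCompletion (Ideal.span {l}) A) := by
    have : Nontrivial (A ⧸ Ideal.span {l} ^ 1) := by
      rw [pow_one]
      refine Ideal.Quotient.nontrivial_iff.2 fun h => hl.not_isUnit ?_
      exact Ideal.span_singleton_eq_top.1 h
    exact (AdicCompletion.evalₐ (Ideal.span {l}) 1).toRingHom.domain_nontrivial
  intro t t' h
  let S := nonZeroDivisors (AdicCompletion (Ideal.span {l}) A)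
  obtain ⟨s, hs⟩ := (IsLocalizedModule.eq_iff_exists S (TensorProduct.mk
    (AdicCompletion (Ideal.span {l}) A) (FractionRing (AdicCompletion (Ideal.span {l}) A))
    (TateModule l M) 1)).1 h
  rw [← sub_eq_zero]
  refine eq_zero_of_smul_eq_zero hl (nonZeroDivisors.ne_zero s.2) (t := t - t') ?_
  rw [smul_sub, sub_eq_zero]
  exact hs

end TateModule

/-- A unipotent element of a ring killed by the prime `p` has `p`-power order. -/
theorem exists_pow_prime_pow_eq_one {E : Type*} [Ring E] (p : ℕ) [Fact p.Prime]
    (hp : (p : E) = 0) {a : E} (ha : IsNilpotent (a - 1)) : ∃ k, a ^ p ^ k = 1 := by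
  obtain ⟨N, hN⟩ := ha
  refine ⟨N, ?_⟩
  have h1 := (Commute.one_right (a - 1)).add_pow_prime_pow_eq (Fact.out : p.Prime) N
  rw [sub_add_cancel, hp, zero_mul, zero_mul, zero_mul, add_zero, one_pow] at h1
  have h2 : N ≤ p ^ N := (Nat.lt_pow_self (Fact.out : p.Prime).one_lt).le
  rw [h1, ← Nat.sub_add_cancel h2, pow_add, hN, mul_zero, zero_add]

namespace DrinfeldModule

variable {Fq : Type*} [Field Fq] [Finite Fq] {K : Type*} [Field K] [Algebra Fq[X] K]

/-- If `σ` acts unipotently on `V_l(φ)`, then a `p`-power of `σ` fixes the `l`-torsion. -/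
theorem exists_pow_fixes_torsion (φ : DrinfeldModule Fq K) (p : ℕ) [Fact p.Prime] [CharP Fq p]
    {l : Fq[X]} (hl : Prime l)
    (hsurj : ∀ x : φ.Points (SeparableClosure K), ∃ y, l • y = x)
    {σ : Gal(SeparableClosure K/K)} (hσ : IsNilpotent (φ.rationalTateRep l σ - 1)) :
    ∃ k, ∀ x : φ.Points (SeparableClosure K), l • x = 0 → (σ ^ p ^ k) x = x := by
  have hp : (p : Module.End (FractionRing (AdicCompletion (Ideal.span {l}) Fq[X]))
      (RationalTateModule l (φ.Points (SeparableClosure K)))) = 0 := by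
    have h1 : (p : Fq[X]) = 0 := CharP.cast_eq_zero _ p
    have h2 : (p : FractionRing (AdicCompletion (Ideal.span {l}) Fq[X])) = 0 := by
      rw [← map_natCast (algebraMap Fq[X] _), h1, map_zero]
    rw [← map_natCast (algebraMap (FractionRing (AdicCompletion (Ideal.span {l}) Fq[X])) _), h2,
      map_zero]
  obtain ⟨k, hk⟩ := exists_pow_prime_pow_eq_one p hp hσ
  refine ⟨k, fun x hx => ?_⟩
  obtain ⟨t, rfl⟩ := TateModule.exists_apply_one_eq hsurj hx
  rw [← map_pow] at hk
  have h1 := TateModule.one_tmul_injective hl (a₁ := TateModule.map (φ.galoisMap (σ ^ p ^ k)) t)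
    (a₂ := t) (LinearMap.congr_fun hk (1 ⊗ₜ t))
  exact congrFun (congrArg Subtype.val h1) 1

end DrinfeldModule

/-! ### Roots of polynomials over integrally closed local rings -/

/-- Factoring out the constant term rather than the leading coefficient suits polynomials whose
constant term alone is known to be a unit: there the inverses of the roots are the integral
elements. -/
theorem Polynomial.Splits.eq_prod_one_sub {L : Type*} [Field L] {G : L[X]} (hs : G.Splits)
    (h0 : G.coeff 0 ≠ 0) :
    G = C (G.coeff 0) * (G.roots.map fun x => 1 - C x⁻¹ * X).prod := by
  have hroot {x : L} (hx : x ∈ G.roots) : x ≠ 0 := by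
    rintro rfl
    exact h0 (coeff_zero_eq_eval_zero G ▸ isRoot_of_mem_roots hx)
  have h1 : (G.roots.map fun x => X - C x).prod =
      C (G.roots.map fun x => -x).prod * (G.roots.map fun x => 1 - C x⁻¹ * X).prod := by
    rw [← Multiset.prod_hom _ (C : L →+* L[X]), Multiset.map_map, ← Multiset.prod_map_mul]
    congr 1
    refine Multiset.map_congr rfl fun x hx => ?_
    have h2 : C x * C x⁻¹ = (1 : L[X]) := by rw [← C_mul, mul_inv_cancel₀ (hroot hx), C_1]
    rw [Function.comp_apply, C_neg]
    linear_combination (-X : L[X]) * h2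
  have h2 : G = C (G.leadingCoeff * (G.roots.map fun x => -x).prod) *
      (G.roots.map fun x => 1 - C x⁻¹ * X).prod := by
    rw [C_mul, mul_assoc, ← h1]
    exact hs.eq_prod_roots
  have h3 : G.coeff 0 = G.leadingCoeff * (G.roots.map fun x => -x).prod := by
    have h4 := congrArg (eval 0) h2
    rw [eval_mul, eval_C, eval_multiset_prod, Multiset.map_map, ← coeff_zero_eq_eval_zero] at h4
    simpa using h4
  rw [h3]
  exact h2

/-- The inverse of a root of a polynomial with unit constant coefficient is integral. -/
theorem exists_algebraMap_eq_inv_of_root {B L : Type*} [CommRing B] [Field L] [Algebra B L]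
    [IsIntegrallyClosedIn B L] {G : B[X]} (hG : IsUnit (G.coeff 0)) {x : L} (hx : x ≠ 0)
    (hroot : eval₂ (algebraMap B L) x G = 0) : ∃ y : B, algebraMap B L y = x⁻¹ := by
  have : Nontrivial B := (algebraMap B L).domain_nontrivial
  rw [← IsIntegrallyClosedIn.isIntegral_iff (R := B)]
  let := invertibleOfNonzero hx
  have h1 := (eval₂_reverse_eq_zero_iff (algebraMap B L) x G).2 hroot
  rw [invOf_eq_inv] at h1
  have hlead : G.reverse.leadingCoeff = G.coeff 0 := by
    rw [reverse_leadingCoeff, trailingCoeff_eq_coeff_zero hG.ne_zero]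
  obtain ⟨v, hv⟩ := hG.exists_left_inv
  refine ⟨C v * G.reverse, ?_, ?_⟩
  · exact monic_C_mul_of_mul_leadingCoeff_eq_one (by rw [hlead, hv])
  · rw [eval₂_mul, h1, mul_zero]

/-- If the constant coefficient of a polynomial `G` and another coefficient are units, then `G` has
a root which is a unit. -/
theorem exists_isUnit_root {B L : Type*} [CommRing B] [IsLocalRing B] [Field L] [Algebra B L]
    [IsIntegrallyClosedIn B L] {G : B[X]} (hs : (G.map (algebraMap B L)).Splits)
    (h0 : IsUnit (G.coeff 0)) {k : ℕ} (hk : k ≠ 0) (hGk : IsUnit (G.coeff k)) :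
    ∃ y : B, IsUnit y ∧ eval₂ (algebraMap B L) (algebraMap B L y)⁻¹ G = 0 := by
  have hinj : Function.Injective (algebraMap B L) := IsIntegralClosure.algebraMap_injective B B L
  have h0' : (G.map (algebraMap B L)).coeff 0 ≠ 0 := by
    rw [coeff_map]
    exact (h0.map _).ne_zero
  have hroot (x : L) (hx : x ∈ (G.map (algebraMap B L)).roots) :
      ∃ y : B, algebraMap B L y = x⁻¹ := by
    have h1 : eval x (G.map (algebraMap B L)) = 0 := isRoot_of_mem_roots hx
    refine exists_algebraMap_eq_inv_of_root h0 ?_ (by rwa [← eval_map])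
    rintro rfl
    exact h0' (by rw [coeff_zero_eq_eval_zero, h1])
  obtain ⟨s, hs'⟩ : ∃ s : Multiset B,
      s.map (algebraMap B L) = (G.map (algebraMap B L)).roots.map fun x => x⁻¹ := by
    generalize (G.map (algebraMap B L)).roots = t at hroot
    induction t using Multiset.induction_on with
    | empty => exact ⟨0, rfl⟩
    | cons a t ih =>
      obtain ⟨s, hs⟩ := ih fun x hx => hroot x (Multiset.mem_cons_of_mem hx)
      obtain ⟨y, hy⟩ := hroot a (Multiset.mem_cons_self a t)
      exact ⟨y ::ₘ s, by rw [Multiset.map_cons, Multiset.map_cons, hs, hy]⟩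
  have hG : G = C (G.coeff 0) * (s.map fun y => 1 - C y * X).prod := by
    apply map_injective _ hinj
    conv_lhs => rw [hs.eq_prod_one_sub h0']
    rw [Polynomial.map_mul, map_C, coeff_map, Polynomial.map_multiset_prod, Multiset.map_map]
    congr 2
    have h1 := congrArg (Multiset.map fun y : L => 1 - C y * X) hs'
    rw [Multiset.map_map, Multiset.map_map] at h1
    refine (h1.symm.trans ?_)
    refine Multiset.map_congr rfl fun y _ => ?_
    simp
  -- If every inverse root were a non-unit, `G` would reduce to a constant, contrary to its unit
  -- coefficient in degree `k`.
  obtain ⟨y, hy, hyu⟩ : ∃ y ∈ s, IsUnit y := by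
    by_contra! hnon
    have h1 := congrArg (fun P => (P.map (IsLocalRing.residue B)).coeff k) hG
    simp only [Polynomial.map_mul, map_C, Polynomial.map_multiset_prod, Multiset.map_map] at h1
    rw [Multiset.prod_eq_one, mul_one, coeff_C, if_neg hk, coeff_map,
      IsLocalRing.residue_eq_zero_iff] at h1
    · exact h1 hGk
    · intro P hP
      obtain ⟨y, hy, rfl⟩ := Multiset.mem_map.1 hP
      have h2 : IsLocalRing.residue B y = 0 := (IsLocalRing.residue_eq_zero_iff y).2 (hnon y hy)
      simp [h2]
  refine ⟨y, hyu, ?_⟩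
  have h1 : algebraMap B L y ∈ s.map (algebraMap B L) := Multiset.mem_map_of_mem _ hy
  rw [hs'] at h1
  obtain ⟨x, hx, hxy⟩ := Multiset.mem_map.1 h1
  rw [← hxy, inv_inv, ← eval_map]
  exact isRoot_of_mem_roots hx

/-! ### Additive polynomials -/

section Additive

/-- All exponents but the first vanish in `L`, so the derivative is the nonzero constant `f 0`. -/
theorem separable_sum_pow_card_sub {L : Type*} [Field L] {q : ℕ} (hq0 : (q : L) = 0) {f : ℕ → L}
    {N : ℕ} (hN : 0 < N) (hf : f 0 ≠ 0) (z : L) :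
    (∑ i ∈ Finset.range N, C (f i) * X ^ q ^ i - C z : L[X]).Separable := by
  have h : derivative (∑ i ∈ Finset.range N, C (f i) * X ^ q ^ i : L[X]) = C (f 0) := by
    rw [derivative_sum, Finset.sum_eq_single 0]
    · simp
    · intro i _ hi
      rw [derivative_C_mul_X_pow, Nat.cast_pow, hq0, zero_pow hi, mul_zero, C_0, zero_mul]
    · intro h
      exact absurd (Finset.mem_range.2 hN) h
  rw [Polynomial.Separable, derivative_sub, derivative_C, sub_zero, h]
  exact ⟨0, C (f 0)⁻¹, by rw [zero_mul, zero_add, ← C_mul, inv_mul_cancel₀ hf, C_1]⟩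

theorem exists_sum_pow_card_eq {L : Type*} [Field L] [IsSepClosed L] {q : ℕ} (hq : 2 ≤ q)
    (hq0 : (q : L) = 0) {f : ℕ → L} {N : ℕ} (hN : 0 < N) (hf : f 0 ≠ 0) (z : L) :
    ∃ x, ∑ i ∈ Finset.range N, f i * x ^ q ^ i = z := by
  have hdeg : (∑ i ∈ Finset.range N, C (f i) * X ^ q ^ i - C z : L[X]).degree ≠ 0 := by
    intro h
    have h1 : (∑ i ∈ Finset.range N, C (f i) * X ^ q ^ i - C z : L[X]).coeff 1 = 0 :=
      coeff_eq_zero_of_degree_lt (h ▸ zero_lt_one)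
    rw [coeff_sub, finsetSum_coeff, Finset.sum_eq_single 0] at h1
    · rw [coeff_C_of_ne_zero one_ne_zero] at h1
      exact hf (by simpa using h1)
    · intro i _ hi
      rw [coeff_C_mul_X_pow, if_neg]
      exact (Nat.one_lt_pow hi hq).ne
    · intro h2
      exact absurd (Finset.mem_range.2 hN) h2
  obtain ⟨x, hx⟩ := IsSepClosed.exists_root _ hdeg (separable_sum_pow_card_sub hq0 hN hf z)
  refine ⟨x, ?_⟩
  simpa [eval_finsetSum, sub_eq_zero] using hx

/-- An additive polynomial with unit linear coefficient and another unit coefficient has a root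
which is a unit. -/
theorem exists_isUnit_sum_pow_card_eq_zero {B L : Type*} [CommRing B] [IsLocalRing B] [Field L]
    [Algebra B L] [IsIntegrallyClosedIn B L] [IsSepClosed L] {q : ℕ} (hq : 2 ≤ q)
    (hq0 : (q : L) = 0) {f : ℕ → B} {N : ℕ} (h0 : IsUnit (f 0)) {j : ℕ} (hj : j ≠ 0) (hjN : j < N)
    (hfj : IsUnit (f j)) :
    ∃ y : B, IsUnit y ∧
      ∑ i ∈ Finset.range N, algebraMap B L (f i) * ((algebraMap B L y)⁻¹) ^ q ^ i = 0 := by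
  -- The additive polynomial divided by `X`, which discards the root `0`.
  let G : B[X] := ∑ i ∈ Finset.range N, C (f i) * X ^ (q ^ i - 1)
  have hpos (i : ℕ) : 0 < q ^ i := pow_pos (by omega) i
  have hcoeff {i : ℕ} (hi : i < N) : G.coeff (q ^ i - 1) = f i := by
    rw [finsetSum_coeff, Finset.sum_eq_single i]
    · rw [coeff_C_mul_X_pow, if_pos rfl]
    · intro i' _ hi'
      rw [coeff_C_mul_X_pow, if_neg]
      intro h
      have h1 := hpos i
      have h2 := hpos i'
      exact hi' (Nat.pow_right_injective hq (show q ^ i' = q ^ i by omega))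
    · intro h
      exact absurd (Finset.mem_range.2 hi) h
  have hN : 0 < N := by omega
  have hGX : X * G.map (algebraMap B L) =
      ∑ i ∈ Finset.range N, C (algebraMap B L (f i)) * X ^ q ^ i - C 0 := by
    rw [C_0, sub_zero, Polynomial.map_sum, Finset.mul_sum]
    refine Finset.sum_congr rfl fun i _ => ?_
    rw [Polynomial.map_mul, map_C, Polynomial.map_pow, map_X, mul_left_comm, ← pow_succ',
      Nat.sub_add_cancel (hpos i)]
  have hsep := separable_sum_pow_card_sub (f := fun i => algebraMap B L (f i)) hq0 hN
    (h0.map (algebraMap B L)).ne_zero 0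
  rw [← hGX] at hsep
  have hsplit : (G.map (algebraMap B L)).Splits :=
    (IsSepClosed.splits_of_separable _ hsep).of_dvd hsep.ne_zero (dvd_mul_left _ _)
  have hG0 : IsUnit (G.coeff 0) := by
    have := hcoeff hN
    rw [pow_zero, Nat.sub_self] at this
    rwa [this]
  have hk : q ^ j - 1 ≠ 0 := by
    have := Nat.one_lt_pow hj hq
    omega
  obtain ⟨y, hy, hroot⟩ := exists_isUnit_root hsplit hG0 hk (by rwa [hcoeff hjN])
  refine ⟨y, hy, ?_⟩
  have h1 := congrArg (eval (algebraMap B L y)⁻¹) hGX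
  rw [eval_mul, eval_map, hroot, mul_zero, C_0, sub_zero, eval_finsetSum] at h1
  simpa using h1.symm

end Additive

/-! ### Torsion points of Drinfeld modules -/

theorem TwistedPoly.evalHom_eq_sum_range {Fq : Type*} [Field Fq] [Finite Fq] {S : Type*}
    [CommRing S] [Algebra Fq[X] S] (L : Type*) [CommRing L] [Algebra Fq[X] L] [Algebra S L]
    {f : TwistedPoly Fq S} {N : ℕ} (hN : ∀ n, N ≤ n → f.coeff n = 0) (x : L) :
    evalHom Fq S L f x =
      ∑ n ∈ Finset.range N, algebraMap S L (f.coeff n) * x ^ (Nat.card Fq ^ n) := by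
  rw [evalHom_apply]
  refine Finset.sum_subset (fun n hn => ?_) fun n _ hn => ?_
  · rw [Finset.mem_range]
    by_contra! h
    exact SkewPolynomial.mem_support_iff.1 hn (hN n h)
  · have : f.coeff n = 0 := SkewPolynomial.notMem_support_iff.1 hn
    rw [this, map_zero, zero_mul]

theorem natCast_natCard_eq_zero (Fq : Type*) [Field Fq] [Finite Fq] (S : Type*) [CommRing S]
    [Algebra Fq[X] S] : (Nat.card Fq : S) = 0 := by
  have := Fintype.ofFinite Fq
  have h : ((Nat.card Fq : ℕ) : Fq) = 0 := by
    rw [Nat.card_eq_fintype_card]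
    exact FiniteField.cast_card_eq_zero Fq
  have h1 := congrArg ((algebraMap Fq[X] S).comp C) h
  rwa [map_natCast, map_zero] at h1

namespace DrinfeldModule

variable {Fq : Type*} [Field Fq] [Finite Fq]

/-- The linear coefficient of `φ_l` is `γ(l) ≠ 0`, so `φ_l - z` is separable. -/
theorem exists_smul_eq {K : Type*} [Field K] [Algebra Fq[X] K] (φ : DrinfeldModule Fq K) (L : Type*)
    [Field L] [Algebra Fq[X] L] [Algebra K L] [IsSepClosed L] {l : Fq[X]}
    (hl : algebraMap Fq[X] K l ≠ 0) (z : φ.Points L) : ∃ x, l • x = z := by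
  obtain ⟨N, hN⟩ := (φ.toRingHom l).exists_coeff_eq_zero
  obtain ⟨x, hx⟩ := exists_sum_pow_card_eq (L := L) (q := Nat.card Fq) Finite.one_lt_card
    (natCast_natCard_eq_zero Fq L) (f := fun n => algebraMap K L ((φ.toRingHom l).coeff n))
    (Nat.succ_pos N) (by
      rw [φ.coeff_zero]
      exact (_root_.map_ne_zero _).2 hl) z
  exact ⟨x, (TwistedPoly.evalHom_eq_sum_range L (N := N + 1)
    (fun n hn => hN n (by omega)) x).trans hx⟩

/-- If `c⁻¹ φ c` has good or stable reduction over the separably closed field `L`, then `φ` has an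
`l`-torsion point of the form `c / y`, with `y` an integral unit. -/
theorem exists_torsion_of_scaling {K : Type*} [Field K] [ValuativeRel K] [Algebra Fq[X] K]
    [Algebra Fq[X] 𝒪[K]] [IsScalarTower Fq[X] 𝒪[K] K] (φ : DrinfeldModule Fq K) {L : Type*}
    [Field L] [Algebra Fq[X] L] [Algebra K L] [Algebra 𝒪[K] L] [IsScalarTower 𝒪[K] K L]
    [IsSepClosed L] [IsLocalRing (integralClosure 𝒪[K] L)] {l : Fq[X]} (hl0 : l.natDegree ≠ 0)
    (hl : IsUnit (algebraMap Fq[X] 𝒪[K] l)) (c : Lˣ)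
    (hint : ∀ i, IsIntegral 𝒪[K]
      (algebraMap K L ((φ.toRingHom X).coeff i) * (c : L) ^ (Nat.card Fq ^ i - 1)))
    {j : ℕ} (hj : 1 ≤ j)
    (hone : algebraMap K L ((φ.toRingHom X).coeff j) * (c : L) ^ (Nat.card Fq ^ j - 1) = 1) :
    ∃ y : integralClosure 𝒪[K] L, IsUnit y ∧
      TwistedPoly.evalHom Fq K L (φ.toRingHom l) (c * (y : L)⁻¹) = 0 := by
  let B := integralClosure 𝒪[K] L
  let : Algebra Fq[X] B := ((algebraMap 𝒪[K] B).comp (algebraMap Fq[X] 𝒪[K])).toAlgebra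
  let θ : Fq[X] →+* TwistedPoly Fq L :=
    TwistedPoly.conj ((TwistedPoly.map Fq (algebraMap K L)).comp φ.toRingHom) c
  have hθ (a : Fq[X]) (n : ℕ) : (θ a).coeff n =
      algebraMap K L ((φ.toRingHom a).coeff n) * (c : L) ^ (Nat.card Fq ^ n - 1) :=
    TwistedPoly.coeff_conj _ c a n
  have hinj : Function.Injective (algebraMap B L) := Subtype.val_injective
  have hθ0 (a : Fq[X]) : (θ a).coeff 0 = algebraMap B L (algebraMap Fq[X] B a) := by
    rw [hθ, φ.coeff_zero, pow_zero, Nat.sub_self, pow_zero, mul_one,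
      IsScalarTower.algebraMap_apply Fq[X] 𝒪[K] K, ← IsScalarTower.algebraMap_apply 𝒪[K] K L]
    rfl
  obtain ⟨θ', hθ'⟩ := TwistedPoly.exists_lift_ringHom hinj θ
    (fun a n => by
      rcases Nat.eq_zero_or_pos n with rfl | hn
      · rw [hθ0]
        exact ⟨_, rfl⟩
      · rw [hθ, coeff_C_eq_zero _ _ hn, map_zero, zero_mul]
        exact zero_mem _)
    (fun n => by
      rw [hθ]
      exact ⟨⟨_, hint n⟩, rfl⟩)
  have hcoeff (a : Fq[X]) (n : ℕ) : algebraMap B L ((θ' a).coeff n) = (θ a).coeff n := by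
    rw [← hθ', TwistedPoly.coeff_map]
  let θbar := (TwistedPoly.map Fq (IsLocalRing.residue B)).comp θ'
  have hθbar (a : Fq[X]) (n : ℕ) :
      (θbar a).coeff n = IsLocalRing.residue B ((θ' a).coeff n) := rfl
  have hC (a : Fq) (n : ℕ) (hn : 0 < n) : (θbar (C a)).coeff n = 0 := by
    have h : (θ' (C a)).coeff n = 0 := hinj <| by
      rw [hcoeff, hθ, coeff_C_eq_zero _ _ hn, map_zero, zero_mul, map_zero]
    rw [hθbar, h, map_zero]
  have hbarj : (θbar X).coeff j ≠ 0 := by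
    have h : (θ' X).coeff j = 1 := hinj <| by rw [hcoeff, hθ, hone, map_one]
    rw [hθbar, h, map_one]
    exact one_ne_zero
  obtain ⟨r, hjr, hr⟩ := TwistedPoly.exists_hasDegree hbarj
  have hl1 : l ≠ 0 := by
    rintro rfl
    exact hl0 natDegree_zero
  -- The reduction of `θ l` has degree `r * l.natDegree > 0`, which supplies a second unit
  -- coefficient besides the constant one.
  have hdeg := TwistedPoly.hasDegree_ringHom θbar hC (hj.trans hjr) hr hl1
  obtain ⟨N, hN⟩ := (φ.toRingHom l).exists_coeff_eq_zero
  have hrl : r * l.natDegree ≠ 0 := mul_ne_zero (by omega) hl0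
  have hrlN : r * l.natDegree < N := by
    by_contra! h
    refine hdeg.1 ?_
    have h1 : (θ' l).coeff (r * l.natDegree) = 0 := hinj <| by
      rw [hcoeff, hθ, hN _ h, map_zero, zero_mul, map_zero]
    rw [hθbar, h1, map_zero]
  obtain ⟨y, hy, hsum⟩ := exists_isUnit_sum_pow_card_eq_zero (B := B) (L := L) (q := Nat.card Fq)
    Finite.one_lt_card (natCast_natCard_eq_zero Fq L) (f := fun n => (θ' l).coeff n) (by
      have h : (θ' l).coeff 0 = algebraMap Fq[X] B l := hinj <| by rw [hcoeff, hθ0]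
      rw [h]
      exact hl.map (algebraMap 𝒪[K] B)) hrl hrlN
    ((IsLocalRing.residue_ne_zero_iff_isUnit _).1 hdeg.1)
  refine ⟨y, hy, ?_⟩
  rw [TwistedPoly.evalHom_eq_sum_range L hN]
  have h2 : ∑ n ∈ Finset.range N, algebraMap K L ((φ.toRingHom l).coeff n) *
      ((c : L) * (y : L)⁻¹) ^ Nat.card Fq ^ n =
      c * ∑ n ∈ Finset.range N, algebraMap B L ((θ' l).coeff n) *
        ((algebraMap B L y)⁻¹) ^ Nat.card Fq ^ n := by
    rw [Finset.mul_sum]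
    refine Finset.sum_congr rfl fun n _ => ?_
    have h3 : (c : L) ^ Nat.card Fq ^ n = c ^ (Nat.card Fq ^ n - 1) * c := by
      rw [← pow_succ, Nat.sub_add_cancel (pow_pos Nat.card_pos n)]
    rw [hcoeff, hθ, mul_pow, h3]
    change _ * (_ * (y : L)⁻¹ ^ _) = _ * (_ * (y : L)⁻¹ ^ _)
    ring
  rw [h2, hsum, mul_zero]

end DrinfeldModule

/-! ### The tame character -/

/-- The cofactor of `ζ - 1` in `ζ^n - 1` is congruent to `n`, hence a unit: roots of unity of order
prime to the residue characteristic inject into the residue field. -/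
theorem eq_one_of_pow_eq_one_of_sub_mem {B : Type*} [CommRing B] [IsLocalRing B] [IsDomain B]
    {n : ℕ} (hn : IsUnit (n : B)) {ζ : B} (hζ : ζ ^ n = 1)
    (h : ζ - 1 ∈ IsLocalRing.maximalIdeal B) : ζ = 1 := by
  have h1 : (∑ i ∈ Finset.range n, ζ ^ i) * (ζ - 1) = 0 := by
    rw [geom_sum_mul, hζ, sub_self]
  have h2 : IsLocalRing.residue B ζ = 1 := by
    rw [← sub_eq_zero, ← map_one (IsLocalRing.residue B), ← map_sub]
    exact (IsLocalRing.residue_eq_zero_iff _).2 h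
  have h3 : IsUnit (∑ i ∈ Finset.range n, ζ ^ i) := by
    rw [← IsLocalRing.residue_ne_zero_iff_isUnit, map_sum]
    simp only [map_pow, h2, one_pow, Finset.sum_const, Finset.card_range, nsmul_eq_mul, mul_one]
    rw [← map_natCast (IsLocalRing.residue B)]
    exact (IsLocalRing.residue_ne_zero_iff_isUnit _).2 hn
  exact sub_eq_zero.1 ((mul_eq_zero.1 h1).resolve_left h3.ne_zero)

section LocalField

variable {K : Type*} [Field K] [ValuativeRel K] [TopologicalSpace K] [IsNonarchimedeanLocalField K]

/-- Inertia moves `x` by `(η - 1) * x`, which lies in the maximal ideal; since `x` is a unit, `η` is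
congruent to `1`. -/
theorem eq_one_of_inertia_apply_eq_mul {n : ℕ}
    (hn : IsUnit (n : integralClosure 𝒪[K] (SeparableClosure K))) (hn0 : n ≠ 0)
    {τ : Gal(SeparableClosure K/K)} (hτ : τ ∈ inertiaGroup K)
    {x : integralClosure 𝒪[K] (SeparableClosure K)} (hx : IsUnit x) {η : SeparableClosure K}
    (hη : η ^ n = 1) (h : τ (x : SeparableClosure K) = η * x) : η = 1 := by
  have hint : IsIntegral 𝒪[K] η := IsIntegral.of_pow (Nat.pos_of_ne_zero hn0) (hη ▸ isIntegral_one)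
  have h1 : (⟨η, hint⟩ : integralClosure 𝒪[K] (SeparableClosure K)) = 1 := by
    refine eq_one_of_pow_eq_one_of_sub_mem hn (Subtype.ext hη) ?_
    have h2 := (mem_inertiaGroup_iff K τ).1 hτ x
    have h3 : τ • x - x = (⟨η, hint⟩ - 1) * x := by
      rw [sub_mul, one_mul]
      exact congrArg (· - x) (Subtype.ext h)
    rw [h3] at h2
    exact ((IsLocalRing.maximalIdeal.isMaximal _).isPrime.mem_or_mem h2).resolve_right
      fun h4 => h4 hx
  exact congrArg Subtype.val h1

/-- A Kummer generator `c`, of degree prime to `p`, such that a `p`-power of `σ` fixes `c / y` for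
an integral unit `y`, is fixed by `σ`. -/
theorem inertia_apply_eq_self (p : ℕ) [Fact p.Prime] [CharP K p] {n : ℕ}
    (hn : IsUnit (n : integralClosure 𝒪[K] (SeparableClosure K))) (hn0 : n ≠ 0)
    {c : SeparableClosure K} (hc0 : c ≠ 0) {g : K}
    (hc : c ^ n = algebraMap K (SeparableClosure K) g)
    {y : integralClosure 𝒪[K] (SeparableClosure K)} (hy : IsUnit y)
    {σ : Gal(SeparableClosure K/K)} (hσ : σ ∈ inertiaGroup K) {k : ℕ}
    (hfix : (σ ^ p ^ k) (c * (y : SeparableClosure K)⁻¹) = c * (y : SeparableClosure K)⁻¹) :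
    σ c = c := by
  have : CharP (SeparableClosure K) p :=
    charP_of_injective_algebraMap (algebraMap K (SeparableClosure K)).injective p
  have hroot (τ : Gal(SeparableClosure K/K)) : (τ c / c) ^ n = 1 := by
    rw [div_pow, ← map_pow, hc, AlgEquiv.commutes, ← hc, div_self (pow_ne_zero n hc0)]
  have hy0 : (y : SeparableClosure K) ≠ 0 := fun h => hy.ne_zero (Subtype.ext h)
  -- Since `c / y` is fixed, `c` and the unit `y` are multiplied by the same root of unity.
  have h1 : (σ ^ p ^ k) c / c = 1 := by
    refine eq_one_of_inertia_apply_eq_mul hn hn0 (pow_mem hσ (p ^ k)) hy (hroot _) ?_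
    have hy1 : (σ ^ p ^ k) (y : SeparableClosure K) ≠ 0 := (_root_.map_ne_zero _).2 hy0
    rw [map_mul, map_inv₀] at hfix
    field_simp at hfix ⊢
    linear_combination -hfix
  set ζ := σ c / c with hζ
  have hζn : ζ ^ n = 1 := hroot σ
  have hζint : IsIntegral 𝒪[K] ζ :=
    IsIntegral.of_pow (Nat.pos_of_ne_zero hn0) (hζn ▸ isIntegral_one)
  have hζ0 : ζ ≠ 0 := div_ne_zero ((_root_.map_ne_zero _).2 hc0) hc0
  -- The same principle applied to the unit `ζ`: inertia fixes `n`-th roots of unity. Iterating `σ`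
  -- then gives `ζ^(p^k) = 1`, and in characteristic `p` this forces `ζ = 1`.
  have h2 : σ ζ / ζ = 1 := by
    refine eq_one_of_inertia_apply_eq_mul hn hn0 hσ (x := ⟨ζ, hζint⟩) ?_ ?_ ?_
    · exact IsUnit.of_pow_eq_one (Subtype.ext hζn) hn0
    · rw [div_pow, ← map_pow, hζn, map_one, div_one]
    · exact (div_mul_cancel₀ _ hζ0).symm
  have h3 : σ ζ = ζ := (div_eq_one_iff_eq hζ0).1 h2
  have h4 (m : ℕ) : (σ ^ m) c = ζ ^ m * c := by
    induction m with
    | zero => simp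
    | succ m ih =>
      rw [pow_succ', AlgEquiv.mul_apply, ih, map_mul, map_pow, h3, pow_succ, mul_assoc, hζ,
        div_mul_cancel₀ _ hc0]
  have h5 : ζ ^ p ^ k = 1 := by
    rwa [h4, mul_div_cancel_right₀ _ hc0] at h1
  have h6 : (ζ - 1) ^ p ^ k = 0 := by
    rw [sub_pow_char_pow, h5, one_pow, sub_self]
  have h7 : ζ = 1 := sub_eq_zero.1 (eq_zero_of_pow_eq_zero h6)
  rw [hζ, div_eq_one_iff_eq hc0] at h7
  exact h7

end LocalField

/-! ### Unipotent inertia implies stable reduction -/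

/-- Compares `x^(1/a)` with `y^(1/b)` without fractional exponents, through a common multiple `e`.
-/
theorem le_of_pow_div_le {Γ : Type*} [LinearOrderedCommGroupWithZero Γ] {x y : Γ} {a b e : ℕ}
    (hab : a * b ≠ 0) (ha : a ∣ e) (hb : b ∣ e) (he : e ≠ 0) (h : x ^ (e / a) ≤ y ^ (e / b)) :
    x ^ b ≤ y ^ a := by
  obtain ⟨u, hu⟩ := ha
  obtain ⟨v, hv⟩ := hb
  have ha0 : 0 < a := Nat.pos_of_ne_zero (left_ne_zero_of_mul hab)
  have hb0 : 0 < b := Nat.pos_of_ne_zero (right_ne_zero_of_mul hab)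
  have h1 : e / a = u := by rw [hu, Nat.mul_div_cancel_left _ ha0]
  have h2 : e / b = v := by rw [hv, Nat.mul_div_cancel_left _ hb0]
  rw [h1, h2] at h
  have h3 := pow_le_pow_left' h (a * b)
  rw [← pow_mul, ← pow_mul] at h3
  rw [show u * (a * b) = b * e by rw [hu]; ring, show v * (a * b) = a * e by rw [hv]; ring,
    pow_mul, pow_mul] at h3
  exact (pow_le_pow_iff_left₀ zero_le zero_le he).1 h3

namespace DrinfeldModule

variable {Fq : Type*} [Field Fq] [Finite Fq] {K : Type*} [Field K] [ValuativeRel K]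
  [Algebra Fq[X] K]

theorem _root_.natCard_pow_sub_one_ne_zero (Fq : Type*) [Field Fq] [Finite Fq] {i : ℕ}
    (hi : 1 ≤ i) : Nat.card Fq ^ i - 1 ≠ 0 := by
  have := Nat.one_lt_pow (by omega : i ≠ 0) (Finite.one_lt_card (α := Fq))
  omega

/-- The first slope of the Newton polygon of `φ_X`. -/
theorem exists_valuation_coeff_slope_max (φ : DrinfeldModule Fq K) :
    ∃ j, 1 ≤ j ∧ (φ.toRingHom X).coeff j ≠ 0 ∧ ∀ i, 1 ≤ i →
      valuation K ((φ.toRingHom X).coeff i) ^ (Nat.card Fq ^ j - 1) ≤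
        valuation K ((φ.toRingHom X).coeff j) ^ (Nat.card Fq ^ i - 1) := by
  let n (i : ℕ) := Nat.card Fq ^ i - 1
  have hn {i : ℕ} (hi : 1 ≤ i) : n i ≠ 0 := natCard_pow_sub_one_ne_zero Fq hi
  -- With this common multiple, maximising `v(g_i)^(e / n i)` amounts to maximising `v(g_i)^(1 / n
  -- i)`.
  let e := ∏ i ∈ Finset.Icc 1 φ.rank, n i
  have he : e ≠ 0 := Finset.prod_ne_zero_iff.2 fun i hi => hn (Finset.mem_Icc.1 hi).1
  have hr : φ.rank ∈ Finset.Icc 1 φ.rank := Finset.mem_Icc.2 ⟨φ.one_le_rank, le_rfl⟩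
  obtain ⟨j, hj, hmax⟩ := Finset.exists_max_image (Finset.Icc 1 φ.rank)
    (fun i => valuation K ((φ.toRingHom X).coeff i) ^ (e / n i)) ⟨_, hr⟩
  have hj1 := (Finset.mem_Icc.1 hj).1
  have hle {i : ℕ} (hi : i ∈ Finset.Icc 1 φ.rank) :
      valuation K ((φ.toRingHom X).coeff i) ^ n j ≤ valuation K ((φ.toRingHom X).coeff j) ^ n i :=
    le_of_pow_div_le (mul_ne_zero (hn (Finset.mem_Icc.1 hi).1) (hn hj1))
      (Finset.dvd_prod_of_mem _ hi) (Finset.dvd_prod_of_mem _ hj) he (hmax i hi)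
  refine ⟨j, hj1, fun h0 => ?_, fun i hi => ?_⟩
  · have h1 := hle hr
    rw [h0, map_zero, zero_pow (hn φ.one_le_rank), le_zero_iff] at h1
    exact φ.coeff_rank_ne_zero ((valuation K).zero_iff.1 (eq_zero_of_pow_eq_zero h1))
  · by_cases hir : i ≤ φ.rank
    · exact hle (Finset.mem_Icc.2 ⟨hi, hir⟩)
    · rw [φ.hasDegree_X.2 i (by omega), map_zero, zero_pow (hn hj1)]
      exact zero_le

/-- Over the separable closure the slope can always be normalised by an `n`-th root `c`; unipotence
shows that `c` is unramified, so an element of `K` does as well. -/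
theorem hasStableReduction_of_unipotent [TopologicalSpace K] [IsNonarchimedeanLocalField K]
    [Algebra Fq[X] 𝒪[K]] [IsScalarTower Fq[X] 𝒪[K] K] (φ : DrinfeldModule Fq K) {l : Fq[X]}
    (hl : Prime l) (hlu : IsUnit (algebraMap Fq[X] 𝒪[K] l))
    (hunip : ∀ σ ∈ inertiaGroup K, IsNilpotent (φ.rationalTateRep l σ - 1)) :
    φ.HasStableReduction := by
  obtain ⟨p, hp⟩ := CharP.exists Fq
  have : Fact p.Prime := ⟨CharP.char_is_prime Fq p⟩
  have : CharP K p :=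
    charP_of_injective_ringHom (f := (algebraMap Fq[X] K).comp C) (RingHom.injective _) p
  obtain ⟨j, hj, hgj, hmax⟩ := φ.exists_valuation_coeff_slope_max
  set n := Nat.card Fq ^ j - 1 with hn
  set g := (φ.toRingHom X).coeff j with hg
  have hn0 : n ≠ 0 := natCard_pow_sub_one_ne_zero Fq hj
  have hnB : (n : integralClosure 𝒪[K] (SeparableClosure K)) = -1 := by
    let : Algebra Fq[X] (integralClosure 𝒪[K] (SeparableClosure K)) :=
      ((algebraMap 𝒪[K] _).comp (algebraMap Fq[X] 𝒪[K])).toAlgebra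
    rw [hn, Nat.cast_sub (Nat.one_le_pow _ _ Nat.card_pos), Nat.cast_pow,
      natCast_natCard_eq_zero Fq, zero_pow (by omega), Nat.cast_one, zero_sub]
  have hnL : (n : SeparableClosure K) ≠ 0 := by
    have h1 := congrArg Subtype.val hnB
    have h2 : (n : SeparableClosure K) = -1 := h1
    rw [h2]
    exact neg_ne_zero.2 one_ne_zero
  have hnu : IsUnit (n : integralClosure 𝒪[K] (SeparableClosure K)) := by
    rw [hnB]
    exact isUnit_one.neg
  have : NeZero (n : SeparableClosure K) := ⟨hnL⟩
  obtain ⟨c, hc⟩ := IsSepClosed.exists_pow_nat_eq (algebraMap K (SeparableClosure K) g⁻¹) n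
  have hc0 : c ≠ 0 := by
    rintro rfl
    rw [zero_pow hn0, eq_comm, map_eq_zero] at hc
    exact inv_ne_zero hgj hc
  have hX : valuation K ((φ.toRingHom X).coeff 0) ≤ 1 := by
    rw [φ.coeff_zero, ← algebraMap_integer_apply]
    exact (algebraMap Fq[X] 𝒪[K] X).2
  have hint (i : ℕ) : IsIntegral 𝒪[K] (algebraMap K (SeparableClosure K)
      ((φ.toRingHom X).coeff i) * c ^ (Nat.card Fq ^ i - 1)) := by
    have key {x : K} (hx : valuation K x ≤ 1) :
        IsIntegral 𝒪[K] (algebraMap K (SeparableClosure K) x) :=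
      isIntegral_algebraMap (R := 𝒪[K]) (x := ⟨x, hx⟩)
    rcases Nat.eq_zero_or_pos i with rfl | hi
    · rw [pow_zero, Nat.sub_self, pow_zero, mul_one]
      exact key hX
    -- The `n`-th power is `g_i^n * (g⁻¹)^(q^i - 1)`, an element of `K` that is integral by the
    -- choice of `j`.
    · refine IsIntegral.of_pow (Nat.pos_of_ne_zero hn0) ?_
      rw [mul_pow, ← pow_mul, mul_comm _ n, pow_mul, hc, ← map_pow, ← map_pow, ← map_mul]
      refine key ?_
      rw [map_mul, map_pow, map_pow, map_inv₀, inv_pow]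
      exact mul_inv_le_one_of_le₀ (hmax i hi) zero_le
  have hone : algebraMap K (SeparableClosure K) g * c ^ n = 1 := by
    rw [hc, ← map_mul, mul_inv_cancel₀ hgj, map_one]
  have hl0 : l.natDegree ≠ 0 := by
    intro h
    obtain ⟨a, rfl⟩ := natDegree_eq_zero.1 h
    exact hl.not_isUnit (isUnit_C.2 (isUnit_iff_ne_zero.2 fun h0 => hl.ne_zero (by rw [h0, C_0])))
  obtain ⟨y, hy, hty⟩ := φ.exists_torsion_of_scaling (L := SeparableClosure K) hl0 hlu
    (Units.mk0 c hc0) hint hj hone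
  have hlK : algebraMap Fq[X] K l ≠ 0 := by
    rw [← algebraMap_integer_apply]
    exact (hlu.map (algebraMap 𝒪[K] K)).ne_zero
  have hfix : ∀ σ ∈ inertiaGroup K, σ c = c := by
    intro σ hσ
    obtain ⟨k, hk⟩ := φ.exists_pow_fixes_torsion p hl
      (φ.exists_smul_eq (SeparableClosure K) hlK) (hunip σ hσ)
    exact inertia_apply_eq_self p hnu hn0 hc0 hc hy hσ (hk _ hty)
  obtain ⟨d, hd0, hd⟩ := exists_valuation_pow_mul_eq_one p hnL hgj hc hfix
  refine φ.hasStableReduction_of_scaling (Units.mk0 d hd0) (fun i => ?_) hj ?_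
  · rw [Units.val_mk0]
    rcases Nat.eq_zero_or_pos i with rfl | hi
    · rw [pow_zero, Nat.sub_self, pow_zero, mul_one]
      exact hX
    · refine (pow_le_one_iff_of_nonneg zero_le hn0).1 ?_
      have hgv : valuation K g ≠ 0 := by simpa using hgj
      have h1 : valuation K d ^ n = (valuation K g)⁻¹ := by
        rw [map_mul, map_pow] at hd
        exact eq_inv_of_mul_eq_one_left hd
      rw [map_mul, mul_pow, map_pow, ← pow_mul, mul_comm _ n, pow_mul, h1, inv_pow]
      exact mul_inv_le_one_of_le₀ (hmax i hi) zero_le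
  · rw [Units.val_mk0, mul_comm]
    exact hd

end DrinfeldModule

end

theorem proposition2p5
    {Fq : Type*} [Field Fq] [Finite Fq]
    {K : Type*} [Field K] [ValuativeRel K] [TopologicalSpace K] [IsNonarchimedeanLocalField K]
    [Algebra Fq[X] K] [Algebra Fq[X] 𝒪[K]] [IsScalarTower Fq[X] 𝒪[K] K]
    (φ ψ : DrinfeldModule Fq K) (u : TwistedPoly Fq K) (hu : φ.IsIsogeny ψ u)
    (l : Fq[X]) (hl : Prime l)
    (hchar : Ideal.span {l} ≠ RingHom.ker (algebraMap Fq[X] 𝓀[K]))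
    (hunip : ∀ σ ∈ inertiaGroup K, IsNilpotent (φ.rationalTateRep l σ - 1)) :
    ψ.HasStableReduction := by
  refine (φ.hasStableReduction_of_unipotent hl ?_ hunip).of_isIsogeny hu
  by_contra hlu
  have hmem : l ∈ RingHom.ker (algebraMap Fq[X] 𝓀[K]) := by
    rw [RingHom.mem_ker]
    exact (IsLocalRing.residue_eq_zero_iff (algebraMap Fq[X] 𝒪[K] l)).2 hlu
  -- A non-unit `l` would lie in the characteristic ideal of the reduction, and `(l)`, being
  -- maximal, would equal it.
  have : (Ideal.span {l}).IsMaximal :=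
    PrincipalIdealRing.isMaximal_of_irreducible hl.irreducible
  exact hchar (this.eq_of_le (RingHom.ker_ne_top _)
    ((Ideal.span_singleton_le_iff_mem _).2 hmem))
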